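/- Let $H$ be a connected (finite-dimensional, real) Lie group, let $d$ be the distance of a right-invariant Riemannian metric on $H$, and let $\{\Phi_t : t\in\mathbb{R}\}$ be a one-parameter group of automorphisms of $H$ (with $(t,g)\mapsto\Phi_t(g)$ continuous) such that $\Phi_t$ is contracting for every $t>0$, i.e. $\Phi_t^k(g)\to e$ as $k\to\infty$ for every $g\in H$. Let $D_0\subset H$ be admissible, i.e. compact with non-empty interior. For $(x,t)\in\Omega=H\times\mathbb{R}$ put $\psi(x,t)=\Phi_t(D_0)x$, and write $(x',t')\le(x,t)$ if and only if $\psi(x',t')\subset\psi(x,t)$. Say that $a_*\ge 0$ satisfies (MSG0) if for every $(x,t)\in\Omega$ and every $s>a_*$ there is $x'\in H$ with $(x',t+s)\le(x,t)$. Given such an $a_*$ and $a,b>a_*$, two players play the following game: Bob chooses $\omega_1=(x_1,t_1)\in\Omega$ arbitrarily; then for $k=1,2,\dots$, Alice chooses $x_k'\in H$ with $\omega_k'=(x_k',t_k+a)\le\omega_k$, and Bob chooses $x_{k+1}\in H$ with $\omega_{k+1}=(x_{k+1},t_{k+1})\le\omega_k'$, where $t_{k+1}=t_k+a+b$. A set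 $S\subset H$ is $(a,b)$-winning if Alice can play so that $\bigcap_{k\ge1}\psi(\omega_k)\subset S$ no matter how Bob plays; it is $a$-winning if it is $(a,b)$-winning for every $b>a_*$, and winning if it is $a$-winning for some $a>a_*$. This is the modified Schmidt game (MSG) induced by $\{\Phi_t : t>0\}$. Then some $a_*\ge0$ satisfies (MSG0), and for every $a_*\ge 0$ satisfying (MSG0), every winning set $S\subset H$ is thick: for every non-empty open $U\subset H$, the Hausdorff dimension of $S\cap U$ (with respect to $d$) equals the Hausdorff dimension of $H$. -/

import Mathlib

open Set Filter Topology
open scoped Manifold ContDiff Bundle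

noncomputable section

namespace ModifiedSchmidt

/-! ### The modified Schmidt game

Positions are points of `Ω = E × ℝ` (so `t_* = -∞`). The game is given by a relation `le` on `Ω`
(the ordering) and a map `ψ` from `Ω` to subsets of `E`. -/

section Game

variable {E : Type*}

/-- The condition that for every position `(x, t)` and every `s > aStar` there is a position
`(x', t + s) ≤ (x, t)`: a player waiting any time larger than `aStar` always has a legal move. -/
def MSG0 (le : E × ℝ → E × ℝ → Prop) (aStar : ℝ) : Prop :=
  ∀ (x : E) (t s : ℝ), aStar < s → ∃ x' : E, le (x', t + s) (x, t)

/-- A strategy of Alice: to every finite sequence `p 0, …, p k` of moves of Bob it assigns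
the point of `E` which Alice chooses in response to `p k`. (Alice's own earlier moves are
determined by Bob's moves and the strategy.) -/
abbrev Strategy (E : Type*) : Type _ := (k : ℕ) → (Fin (k + 1) → E × ℝ) → E

/-- The `k`-th move of Alice when she uses the strategy `σ` with parameter `a` and Bob's moves
are `p 0, p 1, …`; only `p 0, …, p k` matter. -/
def aliceMove (σ : Strategy E) (a : ℝ) (p : ℕ → E × ℝ) (k : ℕ) : E × ℝ :=
  (σ k (fun i => p i), (p k).2 + a)

/-- Bob's `(k+1)`-st move is legal after the `k`-th move of Alice. (His move number `0` is an
arbitrary element of `E × ℝ`.) -/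
def BobLegal (le : E × ℝ → E × ℝ → Prop) (σ : Strategy E) (a b : ℝ) (p : ℕ → E × ℝ) (k : ℕ) :
    Prop :=
  (p (k + 1)).2 = (aliceMove σ a p k).2 + b ∧ le (p (k + 1)) (aliceMove σ a p k)

/-- `S` is `(a, b)`-winning: Alice has a strategy whose move is legal at every stage reached by
legal moves of Bob, and such that in every infinite play the intersection of the chosen sets
is contained in `S`. -/
def IsABWinning (le : E × ℝ → E × ℝ → Prop) (ψ : E × ℝ → Set E) (a b : ℝ) (S : Set E) : Prop :=
  ∃ σ : Strategy E, ∀ p : ℕ → E × ℝ,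
    (∀ n : ℕ, (∀ k < n, BobLegal le σ a b p k) → le (aliceMove σ a p n) (p n)) ∧
    ((∀ k : ℕ, BobLegal le σ a b p k) → ⋂ k, ψ (p k) ⊆ S)

/-- `S` is `a`-winning: it is `(a, b)`-winning for every `b > aStar`. -/
def IsAWinning (le : E × ℝ → E × ℝ → Prop) (ψ : E × ℝ → Set E) (aStar a : ℝ) (S : Set E) :
    Prop :=
  ∀ b : ℝ, aStar < b → IsABWinning le ψ a b S

/-- `S` is winning: it is `a`-winning for some `a > aStar`. -/
def IsWinning (le : E × ℝ → E × ℝ → Prop) (ψ : E × ℝ → Set E) (aStar : ℝ) (S : Set E) : Prop :=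
  ∃ a : ℝ, aStar < a ∧ IsAWinning le ψ aStar a S

end Game

/-- A subset of a metric space `E` is thick if its intersection with every nonempty open set has
full Hausdorff dimension, that is, the Hausdorff dimension of `E`. -/
def IsThick {E : Type*} [MetricSpace E] (S : Set E) : Prop :=
  ∀ U : Set E, IsOpen U → U.Nonempty → dimH (S ∩ U) = dimH (univ : Set E)

/-! ### Contracting one-parameter groups and the games they induce -/

section Contracting

variable {H : Type*} [Group H] [TopologicalSpace H]

/-- `t ↦ Φ t` is a one-parameter group of automorphisms of the topological group `H` such that
`Φ t` is contracting for `t > 0`. (If `H` is a Lie group, every continuous automorphism is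
smooth, so that these are the Lie group automorphisms.) -/
structure IsContractingOneParameterGroup (Φ : ℝ → H ≃ₜ* H) : Prop where
  map_zero : ∀ g : H, Φ 0 g = g
  map_add : ∀ (s t : ℝ) (g : H), Φ (s + t) g = Φ s (Φ t g)
  continuous : Continuous fun p : ℝ × H => Φ p.1 p.2
  contracting : ∀ t : ℝ, 0 < t → ∀ g : H, Tendsto (fun k : ℕ => (Φ t)^[k] g) atTop (𝓝 1)

/-- A subset of `H` is admissible if it is compact and has nonempty interior. -/
def IsAdmissible (D₀ : Set H) : Prop := IsCompact D₀ ∧ (interior D₀).Nonempty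

/-- `ψ (x, t) = Φ_t(D₀) x`. -/
def inducedPsi (Φ : ℝ → H ≃ₜ* H) (D₀ : Set H) (p : H × ℝ) : Set H :=
  (fun g => Φ p.2 g * p.1) '' D₀

/-- `(x', t') ≤ (x, t)` if and only if `ψ (x', t') ⊆ ψ (x, t)`. -/
def inducedLE (Φ : ℝ → H ≃ₜ* H) (D₀ : Set H) (p' p : H × ℝ) : Prop :=
  inducedPsi Φ D₀ p' ⊆ inducedPsi Φ D₀ p

end Contracting

/-- The Riemannian metric of the Lie group `H` is right-invariant: the differential of every right
translation is an isometry on every tangent space. -/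
def IsRightInvariantMetric {V : Type*} [NormedAddCommGroup V] [NormedSpace ℝ V]
    (H : Type*) [Group H] [TopologicalSpace H] [ChartedSpace V H]
    [Bundle.RiemannianBundle (fun x : H => TangentSpace 𝓘(ℝ, V) x)] : Prop :=
  ∀ (g x : H) (v : TangentSpace 𝓘(ℝ, V) x),
    ‖mfderiv 𝓘(ℝ, V) 𝓘(ℝ, V) (fun y : H => y * g) x v‖ = ‖v‖

end ModifiedSchmidt

end

/-! Fix a winning strategy of Alice for parameters `a`, `b`, and let `Δ t` be the factor by which `Φ
t` scales a right Haar measure. For large `b`, some `N ≥ c / Δ b` disjoint translates of `Φ b (D₀)`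
fit into `D₀`, with `c` independent of `b` (`IsAdmissible.exists_packing`). At every stage Bob may
therefore answer Alice in `N` disjoint ways. Playing all of them against the same strategy gives an
`N`-ary tree of nested compact sets, and every branch ends at a point of `S ∩ U`.

Level-`k` sets have measure `m (Δ (a + b)) ^ k` and diameter at most `A exp (-σ (a + b) k)`. As `Δ`
is multiplicative, `N Δ (a + b) ≥ c Δ a`: the proportion of measure lost per level is bounded
independently of `b`, while the scale ratio tends to `0` as `b` grows. The uniform measure on
branches and the mass distribution principle (`IsTreeSystem.le_dimH_range`) then give dimension at
least `s` for every `s < n = dim V`. The opposite bound is `dimH H ≤ n`.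

The geometric input is exponential contraction (`IsLocalLog.exists_dist_le_exp`) and `n`-dimensional
ball growth (`hausdorffMeasure_of_bilipschitz`). Both use a chart at `1` that is additive up to half
the size of the first factor: powers of `g` then leave a ball at a rate comparable to both `‖φ g‖`
and `dist g 1`. -/

/-! ### Right translations are isometries of the Riemannian distance. -/

section Translation
open Manifold MeasureTheory
variable {V : Type*} [NormedAddCommGroup V] [NormedSpace ℝ V]
  {H : Type*} [MetricSpace H] [Group H] [ChartedSpace V H] [LieGroup 𝓘(ℝ, V) ∞ H]
  [Bundle.RiemannianBundle (fun x : H => TangentSpace 𝓘(ℝ, V) x)]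

/-- A nearly minimizing path, translated by `g`, has the same speed by the chain rule, hence the
same length. -/
theorem riemannianEDist_mul_right_le
    (hinv : ModifiedSchmidt.IsRightInvariantMetric (V := V) H) (x y g : H) :
    riemannianEDist 𝓘(ℝ, V) (x * g) (y * g) ≤ riemannianEDist 𝓘(ℝ, V) x y := by
  refine le_of_forall_gt fun r hr => ?_
  obtain ⟨γ, h0, h1, hγ, hlt⟩ := exists_lt_of_riemannianEDist_lt hr
  have hR : ContMDiff 𝓘(ℝ, V) 𝓘(ℝ, V) 1 (fun z : H => z * g) :=
    (contMDiff_mul_right (I := 𝓘(ℝ, V)) (n := ∞) (a := g)).of_le (by simp)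
  refine lt_of_le_of_lt (riemannianEDist_le_pathELength (γ := fun t => γ t * g) (a := 0) (b := 1)
    (hR.comp_contMDiffOn hγ) (by simp [h0]) (by simp [h1]) zero_le_one) ?_
  refine lt_of_le_of_lt (le_of_eq ?_) hlt
  rw [pathELength_eq_lintegral_mfderivWithin_Icc, pathELength_eq_lintegral_mfderivWithin_Icc]
  refine setLIntegral_congr_fun measurableSet_Icc fun t ht => ?_
  have hc : mfderivWithin 𝓘(ℝ, ℝ) 𝓘(ℝ, V) (fun t => γ t * g) (Icc 0 1) t =
      (mfderiv 𝓘(ℝ, V) 𝓘(ℝ, V) (fun z : H => z * g) (γ t)).comp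
        (mfderivWithin 𝓘(ℝ, ℝ) 𝓘(ℝ, V) γ (Icc 0 1) t) :=
    mfderiv_comp_mfderivWithin t (hR.mdifferentiable (by simp) (γ t))
      (hγ.mdifferentiableOn (by simp) t ht)
      (uniqueMDiffWithinAt_iff_uniqueDiffWithinAt.2 (uniqueDiffOn_Icc zero_lt_one t ht))
  simp only [hc]
  rw [← ofReal_norm, ← ofReal_norm]
  congr 1
  exact hinv g (γ t) _

theorem dist_mul_right_eq [IsRiemannianManifold 𝓘(ℝ, V) H]
    (hinv : ModifiedSchmidt.IsRightInvariantMetric (V := V) H) (x y g : H) :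
    dist (x * g) (y * g) = dist x y := by
  have key : ∀ x y g : H, edist (x * g) (y * g) ≤ edist x y := fun x y g => by
    rw [IsRiemannianManifold.out (I := 𝓘(ℝ, V)) x y,
      IsRiemannianManifold.out (I := 𝓘(ℝ, V)) (x * g) (y * g)]
    exact riemannianEDist_mul_right_le hinv x y g
  have h : edist (x * g) (y * g) = edist x y := by
    refine le_antisymm (key x y g) ?_
    simpa using key (x * g) (y * g) g⁻¹
  rw [dist_edist, dist_edist, h]

end Translation

/-! ### Near-additivity of a chart at the identity. -/

section Chart
variable {V : Type*} [NormedAddCommGroup V] [NormedSpace ℝ V]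
  {H : Type*} [TopologicalSpace H] [Group H] [ChartedSpace V H]

variable (V H) in
/-- The preferred chart at the identity of a Lie group, translated so that it sends `1` to `0`. -/
noncomputable def unitChart (g : H) : V :=
  extChartAt 𝓘(ℝ, V) (1 : H) g - extChartAt 𝓘(ℝ, V) (1 : H) 1

@[simp] theorem unitChart_one : unitChart V H 1 = 0 := by simp [unitChart]

theorem image_unitChart_mem_nhds {U : Set H} (hU : U ∈ 𝓝 (1 : H)) :
    unitChart V H '' U ∈ 𝓝 (0 : V) := by
  have h1 : extChartAt 𝓘(ℝ, V) (1 : H) '' U ∈ 𝓝 (extChartAt 𝓘(ℝ, V) (1 : H) 1) := by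
    rw [← map_extChartAt_nhds_of_boundaryless (I := 𝓘(ℝ, V)) (1 : H)]
    exact image_mem_map hU
  have h2 : Tendsto (fun v : V => v + extChartAt 𝓘(ℝ, V) (1 : H) 1) (𝓝 0)
      (𝓝 (extChartAt 𝓘(ℝ, V) (1 : H) 1)) := Continuous.tendsto' (by fun_prop) _ _ (by simp)
  filter_upwards [h2 h1] with v ⟨g, hg, hgv⟩
  exact ⟨g, hg, by simp only [unitChart, hgv, add_sub_cancel_right]⟩

/-- The remainder `G` of the product read in the chart is C¹ and constant on both axes near `0`, so
its derivative at `0` vanishes and it is 1/2-Lipschitz nearby. Comparing `(v, w)` with `(0, w)`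
gives a bound by the first factor alone. -/
theorem exists_norm_unitChart_mul_sub_le [LieGroup 𝓘(ℝ, V) ∞ H] :
    ∃ U ∈ 𝓝 (1 : H), ∀ g ∈ U, ∀ h ∈ U,
      ‖unitChart V H (g * h) - unitChart V H g - unitChart V H h‖ ≤ 1 / 2 * ‖unitChart V H g‖ := by
  set e := extChartAt 𝓘(ℝ, V) (1 : H) with he
  set p : V := e 1 with hp
  set G : V × V → V := fun z => e (e.symm (z.1 + p) * e.symm (z.2 + p)) - z.1 - z.2 with hG
  have hep : e.symm p = 1 := extChartAt_to_inv (I := 𝓘(ℝ, V)) (1 : H)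
  have hsymm : ContMDiffAt 𝓘(ℝ, V) 𝓘(ℝ, V) 1 e.symm p :=
    ((contMDiffOn_extChartAt_symm (I := 𝓘(ℝ, V)) (n := ∞) (1 : H)).contMDiffAt
      (extChartAt_target_mem_nhds (1 : H))).of_le (by simp)
  have h1 : ContMDiffAt 𝓘(ℝ, V × V) 𝓘(ℝ, V) 1 (fun z : V × V => e.symm (z.1 + p)) 0 := by
    refine ContMDiffAt.comp (I' := 𝓘(ℝ, V)) (0 : V × V) (g := e.symm) (f := fun z : V × V => z.1 + p)
      (by simpa using hsymm) ?_
    exact ((contDiff_fst.add contDiff_const).contDiffAt).contMDiffAt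
  have h2 : ContMDiffAt 𝓘(ℝ, V × V) 𝓘(ℝ, V) 1 (fun z : V × V => e.symm (z.2 + p)) 0 := by
    refine ContMDiffAt.comp (I' := 𝓘(ℝ, V)) (0 : V × V) (g := e.symm) (f := fun z : V × V => z.2 + p)
      (by simpa using hsymm) ?_
    exact ((contDiff_snd.add contDiff_const).contDiffAt).contMDiffAt
  have : LieGroup 𝓘(ℝ, V) 1 H := LieGroup.of_le (n := ∞) (by simp)
  have h3 := h1.mul h2
  have hech : ContMDiffAt 𝓘(ℝ, V) 𝓘(ℝ, V) 1 e (1 : H) := contMDiffAt_extChartAt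
  have h4 : ContMDiffAt 𝓘(ℝ, V × V) 𝓘(ℝ, V) 1
      (fun z : V × V => e (e.symm (z.1 + p) * e.symm (z.2 + p))) 0 := by
    refine ContMDiffAt.comp (I' := 𝓘(ℝ, V)) (0 : V × V) (g := e)
      (f := fun z : V × V => e.symm (z.1 + p) * e.symm (z.2 + p)) (by simpa [hep] using hech) h3
  have hGc : ContDiffAt ℝ 1 G 0 :=
    (h4.contDiffAt.sub contDiff_fst.contDiffAt).sub contDiff_snd.contDiffAt
  have hright : ∀ᶠ v in 𝓝 (0 : V), e.symm (v + p) ∈ e.source ∧ e (e.symm (v + p)) = v + p := by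
    have : Tendsto (fun v : V => v + p) (𝓝 0) (𝓝 p) := 
      Continuous.tendsto' (by fun_prop) 0 p (by simp)
    filter_upwards [this.eventually (extChartAt_target_mem_nhds (I := 𝓘(ℝ, V)) (1 : H))] with v hv
    exact ⟨e.map_target hv, e.right_inv hv⟩
  -- The constant is `p` rather than `0` because `e` is not centred.
  have hx0 : ∀ᶠ v in 𝓝 (0 : V), G (v, 0) = p := by
    filter_upwards [hright] with v hv
    simp [hG, hep, hv.2]
  have h0y : ∀ᶠ v in 𝓝 (0 : V), G (0, v) = p := by
    filter_upwards [hright] with v hv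
    simp [hG, hep, hv.2]
  have hs : HasStrictFDerivAt G (fderiv ℝ G 0) 0 := hGc.hasStrictFDerivAt (by simp)
  have hzero : fderiv ℝ G 0 = 0 := by
    have hd := hs.hasFDerivAt
    have a1 : (fderiv ℝ G 0).comp (ContinuousLinearMap.inl ℝ V V) = 0 := by
      have hc : HasFDerivAt (fun v : V => G (v, 0)) ((fderiv ℝ G 0).comp
        (ContinuousLinearMap.inl ℝ V V)) 0 :=
        HasFDerivAt.comp (0 : V) (g := G) (f := fun v => (v, 0)) hd
          (ContinuousLinearMap.inl ℝ V V).hasFDerivAt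
      exact hc.unique ((hasFDerivAt_const p (0 : V)).congr_of_eventuallyEq hx0)
    have a2 : (fderiv ℝ G 0).comp (ContinuousLinearMap.inr ℝ V V) = 0 := by
      have hc : HasFDerivAt (fun v : V => G (0, v)) ((fderiv ℝ G 0).comp
        (ContinuousLinearMap.inr ℝ V V)) 0 :=
        HasFDerivAt.comp (0 : V) (g := G) (f := fun v => (0, v)) hd
          (ContinuousLinearMap.inr ℝ V V).hasFDerivAt
      exact hc.unique ((hasFDerivAt_const p (0 : V)).congr_of_eventuallyEq h0y)
    exact ContinuousLinearMap.prod_ext (by simpa using a1) (by simpa using a2)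
  rw [hzero] at hs
  obtain ⟨W, hW, hlip⟩ := (hs.approximates_deriv_on_nhds (c := 1 / 2) (Or.inr (by norm_num)))
  obtain ⟨W₁, hW₁, W₂, hW₂, hWs⟩ := mem_nhds_prod_iff.1 hW
  have hcont : ContinuousAt (unitChart V H) 1 :=
    (continuousAt_extChartAt (I := 𝓘(ℝ, V)) (1 : H)).sub continuousAt_const
  have hT : Tendsto (unitChart V H) (𝓝 1) (𝓝 0) := by simpa using hcont.tendsto
  have h0W : (0 : V) ∈ W₁ := mem_of_mem_nhds hW₁
  refine ⟨(unitChart V H) ⁻¹' (W₁ ∩ W₂ ∩ {v | G (0, v) = p}) ∩ e.source, inter_mem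
    (hT (inter_mem (inter_mem hW₁ hW₂) h0y)) (extChartAt_source_mem_nhds (1 : H)), ?_⟩
  rintro g ⟨⟨⟨hg1, hg2⟩, hg3⟩, hg4⟩ h ⟨⟨⟨hh1, hh2⟩, hh3⟩, hh4⟩
  have := hlip (x := (unitChart V H g, unitChart V H h)) (hWs ⟨hg1, hh2⟩)
    (y := (0, unitChart V H h)) (hWs ⟨h0W, hh2⟩)
  rw [show G (0, unitChart V H h) = p from hh3] at this
  have eg : e.symm (unitChart V H g + p) = g := by
    simp only [unitChart, ← he, ← hp, sub_add_cancel]; exact e.left_inv hg4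
  have eh : e.symm (unitChart V H h + p) = h := by
    simp only [unitChart, ← he, ← hp, sub_add_cancel]; exact e.left_inv hh4
  simp only [hG, eg, eh] at this
  have e3 : e (g * h) - unitChart V H g - unitChart V H h - p =
      unitChart V H (g * h) - unitChart V H g - unitChart V H h := by
    simp only [unitChart, ← he, ← hp]; abel
  simpa [e3, Prod.norm_def] using this

end Chart

/-! ### From pointwise to uniform contraction on compact sets. -/

section UniformContraction
variable {H : Type*} [Group H] [TopologicalSpace H]

/-- A pointwise contracting endomorphism of a Baire topological group is contracting uniformly on
some neighbourhood of the identity. -/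
theorem exists_nhds_one_forall_iterate_mem [IsTopologicalGroup H] [BaireSpace H] (F : H →* H) (hF : Continuous F)
    (hcon : ∀ g, Tendsto (fun k : ℕ => F^[k] g) atTop (𝓝 1)) {W : Set H} (hW : W ∈ 𝓝 (1 : H)) :
    ∃ U ∈ 𝓝 (1 : H), ∃ n : ℕ, ∀ k ≥ n, ∀ g ∈ U, F^[k] g ∈ W := by
  obtain ⟨W', hW', hdiv⟩ := exists_nhds_split_inv hW
  obtain ⟨C, hC, hCc, hCW⟩ := exists_mem_nhds_isClosed_subset hW'
  -- By Baire, one of these closed sets has an interior point `x`; since `F^[k] g = F^[k] (g * x) /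
  -- F^[k] x`, dividing by `x` moves the uniformity to `1`.
  have hcl : ∀ n : ℕ, IsClosed (⋂ k : ℕ, ⋂ _ : n ≤ k, F^[k] ⁻¹' C) := fun n =>
    isClosed_iInter fun k => isClosed_iInter fun _ => hCc.preimage (hF.iterate k)
  have hun : ⋃ n : ℕ, (⋂ k : ℕ, ⋂ _ : n ≤ k, F^[k] ⁻¹' C) = univ := by
    refine eq_univ_of_forall fun g => ?_
    obtain ⟨n, hn⟩ := eventually_atTop.1 ((hcon g).eventually hC)
    exact mem_iUnion.2 ⟨n, mem_iInter₂.2 fun k hk => hn k hk⟩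
  obtain ⟨n, x, hx⟩ := nonempty_interior_of_iUnion_of_closed hcl hun
  refine ⟨(fun u => u * x) ⁻¹' interior (⋂ k : ℕ, ⋂ _ : n ≤ k, F^[k] ⁻¹' C),
    (isOpen_interior.preimage (continuous_mul_const x)).mem_nhds (by simpa using hx), n,
    fun k hk g hg => ?_⟩
  have h1 : F^[k] (g * x) ∈ C := mem_iInter₂.1 (interior_subset hg) k hk
  have h2 : F^[k] x ∈ C := mem_iInter₂.1 (interior_subset hx) k hk
  have := hdiv _ (hCW h1) _ (hCW h2)
  rwa [iterate_map_mul, mul_div_cancel_right] at this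

theorem IsCompact.exists_forall_iterate_mem [IsTopologicalGroup H] [BaireSpace H] {K : Set H} (hK : IsCompact K)
    (F : H →* H) (hF : Continuous F)
    (hcon : ∀ g, Tendsto (fun k : ℕ => F^[k] g) atTop (𝓝 1)) {W : Set H} (hW : W ∈ 𝓝 (1 : H)) :
    ∃ n : ℕ, ∀ k ≥ n, ∀ g ∈ K, F^[k] g ∈ W := by
  obtain ⟨U, hU, n, hn⟩ := exists_nhds_one_forall_iterate_mem F hF hcon hW
  refine hK.induction_on (p := fun K => ∃ n : ℕ, ∀ k ≥ n, ∀ g ∈ K, F^[k] g ∈ W)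
    ⟨0, by simp⟩ (fun s t hst ⟨n, h⟩ => ⟨n, fun k hk g hg => h k hk g (hst hg)⟩) ?_ ?_
  · rintro s t ⟨n, hn⟩ ⟨m, hm⟩
    refine ⟨max n m, fun k hk g hg => ?_⟩
    rcases hg with hg | hg
    · exact hn k (le_trans (le_max_left _ _) hk) g hg
    · exact hm k (le_trans (le_max_right _ _) hk) g hg
  · intro g _
    obtain ⟨m, hm⟩ := ((hcon g).eventually (interior_mem_nhds.2 hU)).exists
    refine ⟨F^[m] ⁻¹' interior U, mem_nhdsWithin_of_mem_nhds
      ((isOpen_interior.preimage (hF.iterate m)).mem_nhds hm), n + m, fun k hk h hh => ?_⟩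
    obtain ⟨j, rfl⟩ := Nat.exists_eq_add_of_le' (le_trans (Nat.le_add_left m n) hk)
    rw [Function.iterate_add_apply]
    exact hn j (by omega) _ (interior_subset hh)

namespace ModifiedSchmidt.IsContractingOneParameterGroup

variable {Φ : ℝ → H ≃ₜ* H}

theorem iterate_apply (hΦ : IsContractingOneParameterGroup Φ) (t : ℝ) (k : ℕ) (g : H) :
    (Φ t)^[k] g = Φ (k * t) g := by
  induction k with
  | zero => simp [hΦ.map_zero]
  | succ k ih =>
    rw [Function.iterate_succ_apply', ih, ← hΦ.map_add]
    congr 2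
    push_cast
    ring

theorem exists_forall_mem (hΦ : IsContractingOneParameterGroup Φ) [IsTopologicalGroup H] [BaireSpace H] {K : Set H}
    (hK : IsCompact K) {W : Set H} (hW : W ∈ 𝓝 (1 : H)) :
    ∃ T : ℝ, 0 ≤ T ∧ ∀ t, T ≤ t → ∀ g ∈ K, Φ t g ∈ W := by
  -- Compactness of `[0, 1]` takes care of the fractional part of `t`; the integer part is an
  -- iterate of `Φ 1`.
  have hU : ∀ᶠ g in 𝓝 (1 : H), ∀ s ∈ Icc (0 : ℝ) 1, Φ s g ∈ W := by
    refine isCompact_Icc.eventually_forall_of_forall_eventually fun s _ => ?_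
    have hc : Continuous fun z : H × ℝ => Φ z.2 z.1 := hΦ.continuous.comp continuous_swap
    have ht : Tendsto (fun z : H × ℝ => Φ z.2 z.1) (𝓝 (1, s)) (𝓝 1) :=
      hc.tendsto' (1, s) 1 (by simp)
    exact ht.eventually hW
  obtain ⟨n, hn⟩ := hK.exists_forall_iterate_mem ((Φ 1 : H ≃* H) : H →* H)
    (Φ 1).continuous (fun g => hΦ.contracting 1 one_pos g) hU
  refine ⟨n, n.cast_nonneg, fun t ht g hg => ?_⟩
  have ht0 : 0 ≤ t := n.cast_nonneg.trans ht
  have h1 := hn ⌊t⌋₊ (Nat.le_floor ht) g hg (t - ⌊t⌋₊)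
    ⟨sub_nonneg.2 (Nat.floor_le ht0), by linarith [Nat.lt_floor_add_one t]⟩
  have h2 : (⇑((Φ 1 : H ≃* H) : H →* H))^[⌊t⌋₊] g = Φ (⌊t⌋₊ * 1) g :=
    hΦ.iterate_apply 1 ⌊t⌋₊ g
  rwa [h2, ← hΦ.map_add, mul_one, sub_add_cancel] at h1

end ModifiedSchmidt.IsContractingOneParameterGroup
end UniformContraction

/-! ### Escape of powers from a ball, and its metric consequences. -/

section Escape
variable {V : Type*} [NormedAddCommGroup V] [NormedSpace ℝ V]
  {H : Type*} [MetricSpace H] [Group H]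

theorem dist_pow_one_le [IsIsometricSMul Hᵐᵒᵖ H] (g : H) (k : ℕ) : dist (g ^ k) 1 ≤ k * dist g 1 := by
  induction k with
  | zero => simp
  | succ k ih =>
    have h1 : dist (g ^ (k + 1)) (g ^ k) = dist g 1 := by
      rw [pow_succ', ← dist_mul_right g 1 (g ^ k), one_mul]
    have := dist_triangle (g ^ (k + 1)) (g ^ k) 1
    push_cast
    linarith

/-- Supplies an exponent `k` comparable to `R / dist g 1` for which the powers of `g` up to `k` stay
in the ball of radius `R`. -/
theorem exists_nat_mul_lt_le {d R : ℝ} (hd : 0 < d) (hdR : d < R / 2) :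
    ∃ k : ℕ, k * d < R ∧ R ≤ 4 * k * d := by
  have h1 : 1 < R / (2 * d) := by rw [lt_div_iff₀ (by positivity)]; linarith
  have h2 : (⌊R / (2 * d)⌋₊ : ℝ) ≤ R / (2 * d) := Nat.floor_le (by positivity)
  have h3 := Nat.lt_floor_add_one (R / (2 * d))
  have h4 : (1 : ℝ) ≤ ⌊R / (2 * d)⌋₊ := by
    exact_mod_cast Nat.le_floor (by simpa using h1.le)
  refine ⟨⌊R / (2 * d)⌋₊, ?_, ?_⟩
  · rw [le_div_iff₀ (by positivity)] at h2
    nlinarith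
  · rw [div_lt_iff₀ (by positivity)] at h3
    nlinarith

/-- `φ` behaves like a logarithm on the ball of radius `R` about `1`: it is additive up to half of
the size of the first factor. -/
structure IsLocalLog (φ : H → V) (R : ℝ) : Prop where
  pos : 0 < R
  map_one : φ 1 = 0
  norm_map_mul_sub_le : ∀ g ∈ Metric.ball (1 : H) R, ∀ h ∈ Metric.ball (1 : H) R,
    ‖φ (g * h) - φ g - φ h‖ ≤ 1 / 2 * ‖φ g‖
  exists_bound : ∃ M, ∀ g ∈ Metric.ball (1 : H) R, ‖φ g‖ ≤ M

variable {φ : H → V} {R : ℝ}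

namespace IsLocalLog

/-- Multiplying by `g` on the left adds `φ g` with error at most half its norm, so `φ (g ^ k)` stays
within `k / 2 * ‖φ g‖` of `k • φ g`. -/
theorem mul_norm_le_norm_map_pow (hφ : IsLocalLog φ R) {g : H} (hg : g ∈ Metric.ball (1 : H) R)
    (k : ℕ) (hk : ∀ j < k, g ^ j ∈ Metric.ball (1 : H) R) :
    k / 2 * ‖φ g‖ ≤ ‖φ (g ^ k)‖ := by
  have key : ∀ k : ℕ, (∀ j < k, g ^ j ∈ Metric.ball (1 : H) R) →
      ‖φ (g ^ k) - (k : ℝ) • φ g‖ ≤ k / 2 * ‖φ g‖ := by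
    intro k
    induction k with
    | zero => simp [hφ.map_one]
    | succ k ih =>
      intro hk
      have h1 := ih fun j hj => hk j (by omega)
      have h2 := hφ.norm_map_mul_sub_le g hg (g ^ k) (hk k (by omega))
      rw [← pow_succ'] at h2
      have h3 : φ (g ^ (k + 1)) - ((k + 1 : ℕ) : ℝ) • φ g =
          (φ (g ^ (k + 1)) - φ g - φ (g ^ k)) + (φ (g ^ k) - (k : ℝ) • φ g) := by
        push_cast
        rw [add_smul, one_smul]
        abel
      rw [h3]
      refine (norm_add_le _ _).trans ?_
      push_cast
      linarith
  have h1 := key k hk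
  have h2 : ‖(k : ℝ) • φ g‖ = k * ‖φ g‖ := by simp [norm_smul]
  have h3 := norm_sub_norm_le ((k : ℝ) • φ g) (φ (g ^ k))
  rw [norm_sub_rev] at h3
  linarith

/-- With `k` of order `R / dist g 1`, the power `g ^ k` is still in the ball where `φ` is bounded by
`M`, which forces `‖φ g‖ ≤ 2 M / k`. -/
theorem exists_norm_le_mul_dist [IsIsometricSMul Hᵐᵒᵖ H] (hφ : IsLocalLog φ R) :
    ∃ C, 0 < C ∧ ∀ g ∈ Metric.ball (1 : H) (R / 2), ‖φ g‖ ≤ C * dist g 1 := by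
  obtain ⟨M, hM⟩ := hφ.exists_bound
  have hR := hφ.pos
  have hM0 : 0 ≤ M := (norm_nonneg _).trans (hM 1 (Metric.mem_ball_self hR))
  refine ⟨8 * M / R + 1, by positivity, fun g hg => ?_⟩
  rcases eq_or_ne g 1 with rfl | hne
  · simp [hφ.map_one]
  have hd : 0 < dist g 1 := dist_pos.2 hne
  obtain ⟨k, hk1, hk2⟩ := exists_nat_mul_lt_le hd hg
  have hmem : ∀ j ≤ k, g ^ j ∈ Metric.ball (1 : H) R := fun j hj => by
    refine (dist_pow_one_le g j).trans_lt (lt_of_le_of_lt ?_ hk1)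
    gcongr
  have h1 := hφ.mul_norm_le_norm_map_pow (Metric.ball_subset_ball (by linarith) hg) k
    fun j hj => hmem j hj.le
  have h2 := h1.trans (hM _ (hmem k le_rfl))
  have h3 : ‖φ g‖ * R ≤ 8 * M * dist g 1 := by
    calc ‖φ g‖ * R ≤ ‖φ g‖ * (4 * k * dist g 1) := by gcongr
      _ = 8 * (k / 2 * ‖φ g‖) * dist g 1 := by ring
      _ ≤ 8 * M * dist g 1 := by gcongr
  calc ‖φ g‖ ≤ 8 * M * dist g 1 / R := (le_div_iff₀ hR).2 h3
    _ = 8 * M / R * dist g 1 := by ring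
    _ ≤ (8 * M / R + 1) * dist g 1 := by gcongr; linarith

/-- An endomorphism which maps a ball into a sufficiently small ball is a contraction near `1`. -/
theorem exists_forall_dist_map_le [IsIsometricSMul Hᵐᵒᵖ H] (hφ : IsLocalLog φ R) {C₁ : ℝ} (hC₁ : 0 < C₁)
    (hlow : ∀ g ∈ Metric.ball (1 : H) R, dist g 1 ≤ C₁ * ‖φ g‖) :
    ∃ η, 0 < η ∧ η ≤ R / 2 ∧ ∀ f : H →* H,
      (∀ g ∈ Metric.ball (1 : H) R, f g ∈ Metric.ball (1 : H) η) →
      ∀ g ∈ Metric.ball (1 : H) (R / 2), dist (f g) 1 ≤ 1 / 2 * dist g 1 := by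
  obtain ⟨C₂, hC₂, hup⟩ := hφ.exists_norm_le_mul_dist
  have hR := hφ.pos
  -- The second bound makes the final factor `8 * C₁ * C₂ * η` at most `R / 2`.
  refine ⟨min (R / 2) (R / (16 * C₁ * C₂)), by positivity, min_le_left _ _, fun f hf g hg => ?_⟩
  set η := min (R / 2) (R / (16 * C₁ * C₂)) with hη
  have hη1 : η ≤ R / 2 := min_le_left _ _
  have hη2 : η * (16 * C₁ * C₂) ≤ R :=
    (le_div_iff₀ (by positivity)).1 (min_le_right _ _)
  rcases eq_or_ne g 1 with rfl | hne
  · simp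
  have hd : 0 < dist g 1 := dist_pos.2 hne
  obtain ⟨k, hk1, hk2⟩ := exists_nat_mul_lt_le hd hg
  -- As `(f g) ^ j = f (g ^ j)`, the powers of `f g` stay in the tiny ball while those of `g` stay
  -- in the large one; hence `‖φ (f g)‖` is at most of order `η / k`.
  have hmem : ∀ j ≤ k, f g ^ j ∈ Metric.ball (1 : H) η := fun j hj => by
    rw [← map_pow]
    refine hf _ ((dist_pow_one_le g j).trans_lt (lt_of_le_of_lt ?_ hk1))
    gcongr
  have hηR : Metric.ball (1 : H) η ⊆ Metric.ball 1 R := Metric.ball_subset_ball (by linarith)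
  have hfg : f g ∈ Metric.ball (1 : H) η := hf _ (Metric.ball_subset_ball (by linarith) hg)
  have h1 := hφ.mul_norm_le_norm_map_pow (hηR hfg) k fun j hj => hηR (hmem j hj.le)
  have h2 : ‖φ (f g ^ k)‖ ≤ C₂ * η :=
    (hup _ (Metric.ball_subset_ball hη1 (hmem k le_rfl))).trans
      (by gcongr; exact (hmem k le_rfl).le)
  have h3 := hlow _ (hηR hfg)
  have hk0 : 0 < (k : ℝ) := by
    rcases Nat.eq_zero_or_pos k with rfl | h
    · norm_num at hk2; linarith
    · exact_mod_cast h
  have h4 : dist (f g) 1 * R ≤ (1 / 2 * dist g 1) * R := by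
    calc dist (f g) 1 * R ≤ (C₁ * ‖φ (f g)‖) * (4 * k * dist g 1) := by gcongr
      _ = 8 * C₁ * (k / 2 * ‖φ (f g)‖) * dist g 1 := by ring
      _ ≤ 8 * C₁ * (C₂ * η) * dist g 1 := mul_le_mul_of_nonneg_right
          (mul_le_mul_of_nonneg_left (h1.trans h2) (by positivity)) hd.le
      _ = 1 / 2 * (η * (16 * C₁ * C₂)) * dist g 1 := by ring
      _ ≤ 1 / 2 * R * dist g 1 := by gcongr
      _ = (1 / 2 * dist g 1) * R := by ring
  exact le_of_mul_le_mul_right h4 hR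

/-- Near-additivity for `x = (x * y⁻¹) * y` makes `‖φ x - φ y‖` comparable to `‖φ (x * y⁻¹)‖`, and
`dist (x * y⁻¹) 1 = dist x y`. -/
theorem exists_bilipschitz [IsIsometricSMul Hᵐᵒᵖ H] (hφ : IsLocalLog φ R) {C₁ : ℝ}
    (hlow : ∀ g ∈ Metric.ball (1 : H) R, dist g 1 ≤ C₁ * ‖φ g‖) (hC₁ : 0 < C₁) :
    ∃ C, 0 < C ∧ ∀ x ∈ Metric.ball (1 : H) (R / 4), ∀ y ∈ Metric.ball (1 : H) (R / 4),
      dist x y ≤ C * ‖φ x - φ y‖ ∧ ‖φ x - φ y‖ ≤ C * dist x y := by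
  obtain ⟨C₂, hC₂, hup⟩ := hφ.exists_norm_le_mul_dist
  have hR := hφ.pos
  refine ⟨2 * C₁ + 2 * C₂, by positivity, fun x hx y hy => ?_⟩
  have hd : dist (x * y⁻¹) 1 = dist x y := by
    rw [← dist_mul_right (x * y⁻¹) 1 y]; simp
  have hlt : dist (x * y⁻¹) 1 < R / 2 := by
    rw [hd]
    have := dist_triangle_right x y 1
    rw [Metric.mem_ball] at hx hy
    linarith
  have h1 := hφ.norm_map_mul_sub_le (x * y⁻¹) (Metric.ball_subset_ball (by linarith) hlt) y
    (Metric.ball_subset_ball (by linarith) hy)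
  rw [inv_mul_cancel_right, sub_right_comm] at h1
  have h2 := hlow _ (Metric.ball_subset_ball (by linarith) hlt)
  have h3 := hup _ hlt
  rw [hd] at h2 h3
  have h4 := norm_sub_norm_le (φ x - φ y) (φ (x * y⁻¹))
  have h5 := norm_sub_norm_le (φ (x * y⁻¹)) (φ x - φ y)
  rw [norm_sub_rev (φ (x * y⁻¹))] at h5
  have hx0 : 0 ≤ ‖φ x - φ y‖ := norm_nonneg _
  have hd0 : 0 ≤ dist x y := dist_nonneg
  have h6 : ‖φ (x * y⁻¹)‖ ≤ 2 * ‖φ x - φ y‖ := by linarith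
  constructor
  · calc dist x y ≤ C₁ * (2 * ‖φ x - φ y‖) := h2.trans (by gcongr)
      _ ≤ (2 * C₁ + 2 * C₂) * ‖φ x - φ y‖ := by nlinarith
  · nlinarith

end IsLocalLog
end Escape

/-! ### Exponential contraction. -/

section ExponentialContraction
variable {V : Type*} [NormedAddCommGroup V]
  {H : Type*} [MetricSpace H] [Group H]

theorem IsLocalLog.mono {φ : H → V} {R R' : ℝ} (hφ : IsLocalLog φ R) (h0 : 0 < R')
    (hR : R' ≤ R) : IsLocalLog φ R' where
  pos := h0
  map_one := hφ.map_one
  norm_map_mul_sub_le g hg h hh := hφ.norm_map_mul_sub_le g (Metric.ball_subset_ball hR hg) h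
    (Metric.ball_subset_ball hR hh)
  exists_bound := hφ.exists_bound.imp fun _ hM g hg => hM g (Metric.ball_subset_ball hR hg)

open ModifiedSchmidt in
-- Some `Φ T` maps the `R`-ball into the `η`-ball, so it halves distances to `1` on the `R /
-- 2`-ball; iteration gives the rate `log 2 / T`, which does not depend on `K`.
theorem IsLocalLog.exists_dist_le_exp [NormedSpace ℝ V] [IsTopologicalGroup H] [LocallyCompactSpace H]
    [IsIsometricSMul Hᵐᵒᵖ H] {φ : H → V} {R C : ℝ} (hφ : IsLocalLog φ R) (hC : 0 < C)
    (hlow : ∀ g ∈ Metric.ball (1 : H) R, dist g 1 ≤ C * ‖φ g‖)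
    {Φ : ℝ → H ≃ₜ* H} (hΦ : IsContractingOneParameterGroup Φ) :
    ∃ σ : ℝ, 0 < σ ∧ ∀ K : Set H, IsCompact K → ∃ B, 0 < B ∧
      ∀ t, 0 ≤ t → ∀ g ∈ K, dist (Φ t g) 1 ≤ B * Real.exp (-σ * t) := by
  wlog hcpt : IsCompact (Metric.closedBall (1 : H) R) generalizing R with h
  · obtain ⟨ε, hε, hcpt⟩ := Metric.exists_isCompact_closedBall (1 : H)
    refine h (R := min R ε) (hφ.mono (lt_min hφ.pos hε) (min_le_left _ _))
      (fun g hg => hlow g (Metric.ball_subset_ball (min_le_left _ _) hg)) ?_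
    exact hcpt.of_isClosed_subset Metric.isClosed_closedBall
      (Metric.closedBall_subset_closedBall (min_le_right _ _))
  have hR := hφ.pos
  obtain ⟨η, hη, hηR, hη'⟩ := hφ.exists_forall_dist_map_le hC hlow
  obtain ⟨T₁, hT₁, hT₁'⟩ := hΦ.exists_forall_mem hcpt (Metric.ball_mem_nhds (1 : H) hη)
  set T := max T₁ 1 with hT
  have hT0 : 0 < T := lt_of_lt_of_le one_pos (le_max_right _ _)
  have hstep : ∀ g ∈ Metric.ball (1 : H) (R / 2), dist (Φ T g) 1 ≤ 1 / 2 * dist g 1 :=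
    hη' ((Φ T : H ≃* H) : H →* H) fun g hg =>
      hT₁' T (le_max_left _ _) g (Metric.ball_subset_closedBall hg)
  have hiter : ∀ m : ℕ, ∀ g ∈ Metric.ball (1 : H) (R / 2),
      dist (Φ (m * T) g) 1 ≤ (1 / 2) ^ m * (R / 2) := by
    intro m
    induction m with
    | zero => intro g hg; simpa [hΦ.map_zero] using (Metric.mem_ball.1 hg).le
    | succ m ih =>
      intro g hg
      have h1 := ih g hg
      have h2 : (1 / 2 : ℝ) ^ m ≤ 1 := pow_le_one₀ (by norm_num) (by norm_num)
      have hlt : dist (Φ (m * T) g) 1 < R / 2 := by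
        rcases Nat.eq_zero_or_pos m with rfl | hm
        · simpa [hΦ.map_zero] using hg
        · refine h1.trans_lt ?_
          have : (1 / 2 : ℝ) ^ m < 1 := pow_lt_one₀ (by norm_num) (by norm_num) hm.ne'
          nlinarith
      have h3 := hstep _ hlt
      rw [← hΦ.map_add] at h3
      have e : ((m + 1 : ℕ) : ℝ) * T = T + m * T := by push_cast; ring
      rw [e, pow_succ]
      linarith
  refine ⟨Real.log 2 / T, by positivity, fun K hK => ?_⟩
  set σ := Real.log 2 / T with hσ
  have hσ0 : 0 < σ := by positivity
  obtain ⟨T₀, hT₀, hT₀'⟩ := hΦ.exists_forall_mem hK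
    (Metric.ball_mem_nhds (1 : H) (half_pos hR))
  have hcont : Continuous fun z : ℝ × H => dist (Φ z.1 z.2) 1 :=
    hΦ.continuous.dist continuous_const
  obtain ⟨M, hM⟩ := ((isCompact_Icc (a := (0 : ℝ)) (b := T₀)).prod hK).bddAbove_image
    hcont.continuousOn
  -- The first term serves `t ≥ T₀`, where the extra `T` absorbs the rounding of `(t - T₀) / T`; the
  -- second serves `t ≤ T₀`.
  refine ⟨R / 2 * Real.exp (σ * (T₀ + T)) + |M| * Real.exp (σ * T₀), by positivity,
    fun t ht g hg => ?_⟩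
  have e1 : 0 < Real.exp (-σ * t) := Real.exp_pos _
  rw [add_mul, mul_assoc, mul_assoc, ← Real.exp_add, ← Real.exp_add]
  rcases le_total t T₀ with h | h
  · have h1 : dist (Φ t g) 1 ≤ M := hM ⟨(t, g), ⟨⟨ht, h⟩, hg⟩, rfl⟩
    have h2 : 1 ≤ Real.exp (σ * T₀ + -σ * t) := Real.one_le_exp (by nlinarith)
    have h3 : |M| ≤ |M| * Real.exp (σ * T₀ + -σ * t) := le_mul_of_one_le_right (abs_nonneg M) h2
    have h4 : 0 ≤ R / 2 * Real.exp (σ * (T₀ + T) + -σ * t) := by positivity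
    linarith [le_abs_self M]
  · set m := ⌊(t - T₀) / T⌋₊ with hm
    have hm1 : m * T ≤ t - T₀ :=
      (le_div_iff₀ hT0).1 (Nat.floor_le (div_nonneg (by linarith) hT0.le))
    have hm2 : t - T₀ < (m + 1) * T := (div_lt_iff₀ hT0).1 (Nat.lt_floor_add_one _)
    have h1 := hiter m (Φ (t - m * T) g) (hT₀' _ (by linarith) g hg)
    rw [← hΦ.map_add, add_sub_cancel] at h1
    have h2 : (1 / 2 : ℝ) ^ m = Real.exp (-(m * Real.log 2)) := by
      rw [Real.exp_neg, Real.exp_nat_mul, Real.exp_log two_pos, one_div, inv_pow]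
    have h3 : (1 / 2 : ℝ) ^ m ≤ Real.exp (σ * (T₀ + T) + -σ * t) := by
      rw [h2]
      apply Real.exp_le_exp.2
      have : (m : ℝ) * Real.log 2 = σ * (m * T) := by rw [hσ]; field_simp
      rw [this]
      nlinarith
    have h4 : 0 ≤ |M| * Real.exp (σ * T₀ + -σ * t) := by positivity
    have h5 : (1 / 2 : ℝ) ^ m * (R / 2) ≤ R / 2 * Real.exp (σ * (T₀ + T) + -σ * t) := by
      rw [mul_comm]; gcongr
    linarith

end ExponentialContraction

/-! ### The chart as a local logarithm. -/

section LocalLogUnitChart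
open Manifold
variable {V : Type*} [NormedAddCommGroup V] [NormedSpace ℝ V]
  {H : Type*} [MetricSpace H] [Group H] [ChartedSpace V H] [LieGroup 𝓘(ℝ, V) ∞ H]
  [Bundle.RiemannianBundle (fun x : H => TangentSpace 𝓘(ℝ, V) x)]
  [IsContMDiffRiemannianBundle 𝓘(ℝ, V) ∞ V (fun x : H => TangentSpace 𝓘(ℝ, V) x)]
  [IsRiemannianManifold 𝓘(ℝ, V) H]

variable (V H) in
-- Only the bound of distance by the chart norm needs the Riemannian metric; the reverse follows
-- from `IsLocalLog.exists_norm_le_mul_dist`.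
theorem exists_isLocalLog_unitChart :
    ∃ R C : ℝ, IsLocalLog (unitChart V H) R ∧ 0 < C ∧
      ∀ g ∈ Metric.ball (1 : H) R, dist g 1 ≤ C * ‖unitChart V H g‖ := by
  have : IsManifold 𝓘(ℝ, V) 1 H := IsManifold.of_le (n := ∞) (by simp)
  have : IsContinuousRiemannianBundle V (fun x : H => TangentSpace 𝓘(ℝ, V) x) := by
    obtain ⟨q, hq, hqi⟩ := IsContMDiffRiemannianBundle.exists_contMDiff (IB := 𝓘(ℝ, V)) (n := ∞)
      (F := V) (E := fun x : H => TangentSpace 𝓘(ℝ, V) x)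
    exact ⟨q, hq.continuous, hqi⟩
  obtain ⟨U, hU, hmul⟩ := exists_norm_unitChart_mul_sub_le (V := V) (H := H)
  obtain ⟨C, hC, hlow⟩ := eventually_riemannianEDist_le_edist_extChartAt 𝓘(ℝ, V) (1 : H)
  have hcont : ContinuousAt (unitChart V H) 1 :=
    (continuousAt_extChartAt (I := 𝓘(ℝ, V)) (1 : H)).sub continuousAt_const
  have hb : ∀ᶠ g in 𝓝 (1 : H), ‖unitChart V H g‖ < 1 :=
    hcont.norm.eventually_lt continuousAt_const (by simp)
  obtain ⟨R, hR, hRs⟩ := Metric.mem_nhds_iff.1 (inter_mem hU (inter_mem hlow hb))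
  refine ⟨R, C, ⟨hR, unitChart_one, fun g hg h hh => hmul g (hRs hg).1 h (hRs hh).1,
    1, fun g hg => le_of_lt (hRs hg).2.2⟩, hC, fun g hg => ?_⟩
  have h1 : riemannianEDist 𝓘(ℝ, V) 1 g ≤
    C * edist (extChartAt 𝓘(ℝ, V) (1 : H) 1) (extChartAt 𝓘(ℝ, V) (1 : H) g) := (hRs hg).2.1
  rw [← IsRiemannianManifold.out (I := 𝓘(ℝ, V)) (1 : H) g, edist_dist, edist_dist,
    ← ENNReal.ofReal_coe_nnreal, ← ENNReal.ofReal_mul C.coe_nonneg,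
    ENNReal.ofReal_le_ofReal_iff (by positivity)] at h1
  rwa [dist_comm, dist_comm (extChartAt 𝓘(ℝ, V) (1 : H) 1), dist_eq_norm] at h1

end LocalLogUnitChart

/-! ### Second countability from connectedness. -/

section SecondCountable
open scoped Pointwise

/-- The compact sets `(K ∪ K⁻¹) ^ n` have a clopen union: the factor `K` gives openness, `K⁻¹`
closedness. -/
theorem secondCountableTopology_of_connected_locallyCompact_group (H : Type*) [MetricSpace H]
    [Group H] [IsTopologicalGroup H] [ConnectedSpace H] [LocallyCompactSpace H] :
    SecondCountableTopology H := by
  obtain ⟨K, hK, hK1⟩ := exists_compact_mem_nhds (1 : H)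
  let L : ℕ → Set H := fun n => Nat.rec {1} (fun _ s => s * (K ∪ K⁻¹)) n
  have hL : ∀ n, IsCompact (L n) := by
    intro n
    induction n with
    | zero => exact isCompact_singleton
    | succ n ih => exact ih.mul (hK.union hK.inv)
  have hop : IsOpen (⋃ n, L n) := by
    rw [isOpen_iff_mem_nhds]
    intro x hx
    obtain ⟨n, hn⟩ := mem_iUnion.1 hx
    have : (fun y => x⁻¹ * y) ⁻¹' K ∈ 𝓝 x :=
      (continuous_const_mul x⁻¹).continuousAt.preimage_mem_nhds (by simpa using hK1)
    filter_upwards [this] with y hy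
    exact mem_iUnion.2 ⟨n + 1, ⟨x, hn, x⁻¹ * y, Or.inl hy, by simp⟩⟩
  have hcl : IsClosed (⋃ n, L n) := by
    rw [← isOpen_compl_iff, isOpen_iff_mem_nhds]
    intro x hx
    have : (fun y => x⁻¹ * y) ⁻¹' K ∈ 𝓝 x :=
      (continuous_const_mul x⁻¹).continuousAt.preimage_mem_nhds (by simpa using hK1)
    filter_upwards [this] with y hy hyL
    obtain ⟨n, hn⟩ := mem_iUnion.1 hyL
    refine hx (mem_iUnion.2 ⟨n + 1, ⟨y, hn, y⁻¹ * x, Or.inr ?_, by simp⟩⟩)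
    simpa using hy
  have huniv : ⋃ n, L n = univ :=
    IsClopen.eq_univ ⟨hcl, hop⟩ ⟨1, mem_iUnion.2 ⟨0, mem_singleton 1⟩⟩
  have : SigmaCompactSpace H := ⟨⟨L, hL, huniv⟩⟩
  exact EMetric.secondCountable_of_sigmaCompact H

end SecondCountable

/-! ### Hausdorff measure as a right Haar measure. -/

section HausdorffMeasure
open MeasureTheory Measure Module
open scoped ENNReal NNReal

variable {V : Type*} [NormedAddCommGroup V] [NormedSpace ℝ V] [FiniteDimensional ℝ V]
  {H : Type*} [MetricSpace H] [Group H] [IsTopologicalGroup H] [IsIsometricSMul Hᵐᵒᵖ H]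
  [MeasurableSpace H] [BorelSpace H]

/-- On a group with right-invariant metric which near `1` is bi-Lipschitz to a neighbourhood of the
origin of a normed space of dimension `n`, the `n`-dimensional Hausdorff measure is a right Haar
measure with the expected growth of balls. -/
theorem hausdorffMeasure_of_bilipschitz {φ : H → V} {r C : ℝ} (hr : 0 < r) (hC : 0 < C)
    (hone : φ 1 = 0)
    (hbi : ∀ x ∈ Metric.ball (1 : H) r, ∀ y ∈ Metric.ball (1 : H) r,
      dist x y ≤ C * ‖φ x - φ y‖ ∧ ‖φ x - φ y‖ ≤ C * dist x y)
    (hnhds : ∀ U ∈ 𝓝 (1 : H), φ '' U ∈ 𝓝 (0 : V)) :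
    IsLocallyFiniteMeasure (μH[finrank ℝ V] : Measure H) ∧
    IsOpenPosMeasure (μH[finrank ℝ V] : Measure H) ∧
    ∃ B : ℝ, 0 < B ∧ ∀ ρ, 0 < ρ → ρ < r → ∀ x : H,
      (μH[finrank ℝ V] : Measure H) (Metric.closedBall x ρ) ≤
        ENNReal.ofReal (B * ρ ^ finrank ℝ V) := by
  let _ : MeasurableSpace V := borel V
  have : BorelSpace V := ⟨rfl⟩
  set n := finrank ℝ V with hn
  set c : ℝ≥0 := ⟨C, hC.le⟩ with hc
  have hcC : (c : ℝ) = C := rfl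
  have hc0 : c ≠ 0 := fun h => hC.ne' (congrArg NNReal.toReal h)
  have hinj : InjOn φ (Metric.ball 1 r) := fun x hx y hy hxy => by
    have := (hbi x hx y hy).1
    rw [hxy, sub_self, norm_zero, mul_zero] at this
    exact dist_le_zero.1 this
  have hlip : LipschitzOnWith c φ (Metric.ball 1 r) :=
    LipschitzOnWith.of_dist_le_mul fun x hx y hy => by
      rw [dist_eq_norm]; exact (hbi x hx y hy).2
  have hleft : LeftInvOn (Function.invFunOn φ (Metric.ball 1 r)) φ (Metric.ball 1 r) :=
    hinj.leftInvOn_invFunOn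
  have hlip' : LipschitzOnWith c (Function.invFunOn φ (Metric.ball 1 r))
      (φ '' Metric.ball 1 r) := by
    refine LipschitzOnWith.of_dist_le_mul ?_
    rintro _ ⟨x, hx, rfl⟩ _ ⟨y, hy, rfl⟩
    rw [hleft hx, hleft hy, dist_eq_norm]
    exact (hbi x hx y hy).1
  -- `φ` and its inverse are `C`-Lipschitz, so each changes `μH[n]` by a factor at most `C ^ n`; on
  -- `V` it is a Haar measure.
  have hle : ∀ s ⊆ Metric.ball (1 : H) r, (μH[n] : Measure H) s ≤
      (c : ℝ≥0∞) ^ (n : ℝ) * (μH[n] : Measure V) (φ '' s) := fun s hs => by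
    have := (hlip'.mono (image_mono hs)).hausdorffMeasure_image_le (d := n) n.cast_nonneg
    rwa [(hleft.mono hs).image_image] at this
  have hge : ∀ s ⊆ Metric.ball (1 : H) r, (μH[n] : Measure V) (φ '' s) ≤
      (c : ℝ≥0∞) ^ (n : ℝ) * (μH[n] : Measure H) s := fun s hs =>
    (hlip.mono hs).hausdorffMeasure_image_le (d := n) n.cast_nonneg
  have htrans : ∀ (ρ : ℝ) (x : H), (μH[n] : Measure H) (Metric.closedBall x ρ) =
      (μH[n] : Measure H) (Metric.closedBall 1 ρ) := fun ρ x => by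
    rw [← measure_preimage_mul_right (μH[n] : Measure H) x]
    congr 1
    ext y
    simp only [mem_preimage, Metric.mem_closedBall]
    rw [← dist_mul_right y 1 x, one_mul]
  set b : ℝ≥0∞ := (μH[n] : Measure V) (Metric.ball 0 1) with hb
  have hbt : b ≠ ⊤ := measure_ball_lt_top.ne
  have hball : ∀ ρ, 0 < ρ → ρ < r → ∀ x : H, (μH[n] : Measure H) (Metric.closedBall x ρ) ≤
        ENNReal.ofReal ((C ^ n * C ^ n * b.toReal + 1) * ρ ^ n) := by
    intro ρ hρ hρr x
    rw [htrans]
    have hsub : φ '' Metric.closedBall 1 ρ ⊆ Metric.closedBall 0 (C * ρ) := by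
      rintro _ ⟨y, hy, rfl⟩
      have := (hbi y (Metric.closedBall_subset_ball hρr hy) 1 (Metric.mem_ball_self hr)).2
      rw [hone, sub_zero] at this
      rw [mem_closedBall_zero_iff]
      exact this.trans (by gcongr; exact hy)
    calc (μH[n] : Measure H) (Metric.closedBall 1 ρ)
        ≤ (c : ℝ≥0∞) ^ (n : ℝ) * (μH[n] : Measure V) (φ '' Metric.closedBall 1 ρ) :=
          hle _ (Metric.closedBall_subset_ball hρr)
      _ ≤ (c : ℝ≥0∞) ^ (n : ℝ) * (μH[n] : Measure V) (Metric.closedBall 0 (C * ρ)) := by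
          gcongr
      _ = (c : ℝ≥0∞) ^ (n : ℝ) * (ENNReal.ofReal ((C * ρ) ^ n) * b) := by
          rw [addHaar_closedBall _ _ (by positivity)]
      _ = ENNReal.ofReal (C ^ n * C ^ n * b.toReal * ρ ^ n) := by
          rw [ENNReal.rpow_natCast, ← ENNReal.ofReal_coe_nnreal, hcC,
            ← ENNReal.ofReal_pow hC.le, ← ENNReal.ofReal_toReal hbt,
            ← ENNReal.ofReal_mul (by positivity), ← ENNReal.ofReal_mul (by positivity)]
          rw [ENNReal.toReal_ofReal ENNReal.toReal_nonneg]
          congr 1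
          ring
      _ ≤ _ := by
          apply ENNReal.ofReal_le_ofReal
          gcongr
          linarith
  refine ⟨⟨fun x => ?_⟩, ⟨fun U hU hne => ?_⟩, _, by positivity, hball⟩
  · exact ⟨Metric.closedBall x (r / 2), Metric.closedBall_mem_nhds x (by positivity),
      (hball (r / 2) (by positivity) (by linarith) x).trans_lt ENNReal.ofReal_lt_top⟩
  · obtain ⟨x, hx⟩ := hne
    have hmem : (fun y => y * x) ⁻¹' U ∩ Metric.ball 1 r ∈ 𝓝 (1 : H) :=
      inter_mem ((hU.preimage (continuous_mul_const x)).mem_nhds (by simpa using hx))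
        (Metric.ball_mem_nhds 1 hr)
    have hpos : 0 < (μH[n] : Measure V) (φ '' ((fun y => y * x) ⁻¹' U ∩ Metric.ball 1 r)) :=
      measure_pos_of_mem_nhds _ (hnhds _ hmem)
    intro h0
    have h1 : (μH[n] : Measure H) ((fun y => y * x) ⁻¹' U ∩ Metric.ball 1 r) = 0 := by
      refine measure_mono_null inter_subset_left ?_
      rw [measure_preimage_mul_right]
      exact h0
    have h2 := hge _ (inter_subset_right : (fun y => y * x) ⁻¹' U ∩ Metric.ball 1 r ⊆ _)
    rw [h1, mul_zero] at h2
    exact hpos.not_ge h2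

theorem dimH_univ_le_of_sigmaCompact {X : Type*} [MetricSpace X] [SigmaCompactSpace X]
    [MeasurableSpace X] [BorelSpace X] (n : ℕ) [IsLocallyFiniteMeasure (μH[n] : Measure X)] :
    dimH (univ : Set X) ≤ n := by
  rw [← iUnion_compactCovering, dimH_iUnion]
  refine iSup_le fun k => ?_
  exact_mod_cast dimH_le_of_hausdorffMeasure_ne_top (d := n)
    (by exact_mod_cast ((isCompact_compactCovering X k).measure_lt_top
      (μ := (μH[n] : Measure X))).ne)

end HausdorffMeasure

/-! ### The modulus of an automorphism. -/

section Modulus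
open MeasureTheory Measure
open scoped ENNReal

theorem exists_measure_image_eq_mul {H : Type*} [Group H] [TopologicalSpace H]
    [IsTopologicalGroup H] [LocallyCompactSpace H] [MeasurableSpace H] [BorelSpace H]
    (μ : Measure H) [IsMulRightInvariant μ] [IsOpenPosMeasure μ]
    [Regular μ] (f : H ≃ₜ* H) :
    ∃ c : ℝ≥0∞, c ≠ 0 ∧ c ≠ ⊤ ∧ ∀ A, μ (f '' A) = c * μ A := by
  -- Inversion turns the right-invariant `μ` into a left Haar measure, the setting of
  -- `mulEquivHaarChar`; accordingly `A` is replaced by `A⁻¹`.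
  have : IsHaarMeasure μ.inv := {}
  refine ⟨mulEquivHaarChar f, by simpa using (mulEquivHaarChar_pos f).ne', by simp, fun A => ?_⟩
  have h : μ.inv (f '' A⁻¹) = mulEquivHaarChar f * μ.inv A⁻¹ := by
    conv_lhs => rw [← mulEquivHaarChar_smul_map μ.inv f]
    have hmap : map f μ.inv (f '' A⁻¹) = _ :=
      f.toHomeomorph.measurableEmbedding.map_apply μ.inv (f '' A⁻¹)
    rw [Measure.smul_apply, hmap]
    have : ⇑f.toHomeomorph ⁻¹' (f '' A⁻¹) = A⁻¹ := preimage_image_eq _ f.injective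
    rw [this, ENNReal.smul_def, smul_eq_mul]
  have himg : f '' A⁻¹ = (f '' A)⁻¹ := by
    rw [← image_inv_eq_inv, ← image_inv_eq_inv, image_image, image_image]
    simp
  rwa [himg, inv_apply, inv_apply, inv_inv, inv_inv] at h

end Modulus

/-! ### Mass distribution on a tree of sets. -/

section Tree
open MeasureTheory Measure
open scoped ENNReal NNReal

/-- The cylinder of all sequences with given first `k` entries has uniform measure `N⁻ᵏ`. -/
theorem infinitePi_uniform_cylinder (N : ℕ) [NeZero N] (k : ℕ) (v : Fin k → Fin N) :
    infinitePi (fun _ : ℕ => (PMF.uniformOfFintype (Fin N)).toMeasure)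
      {w | ∀ i : Fin k, w i = v i} = ((N : ℝ≥0∞)⁻¹) ^ k := by
  have h : {w : ℕ → Fin N | ∀ i : Fin k, w i = v i} =
      Set.pi (Finset.range k) (fun j => if h : j < k then {v ⟨j, h⟩} else univ) := by
    ext w
    simp only [mem_ofPred_eq, Set.mem_pi, Finset.coe_range, mem_Iio]
    constructor
    · intro hw j hj
      simpa [hj] using hw ⟨j, hj⟩
    · intro hw i
      simpa using hw i i.2
  rw [h, infinitePi_pi _ (fun i _ => .of_discrete)]
  have : ∀ j ∈ Finset.range k, (PMF.uniformOfFintype (Fin N)).toMeasure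
      (if h : j < k then {v ⟨j, h⟩} else univ) = (N : ℝ≥0∞)⁻¹ := by
    intro j hj
    rw [dif_pos (Finset.mem_range.1 hj), PMF.toMeasure_apply_singleton _ _ (.of_discrete)]
    simp
  rw [Finset.prod_congr rfl this]
  simp

variable {X : Type*} [MetricSpace X] [MeasurableSpace X] {N : ℕ}

/-- A system of nested sets indexed by the infinite `N`-ary tree, with a point `f w` in the
intersection of the sets along each branch `w`. Sets at level `k` depend on the first `k` entries,
distinct ones are disjoint, their diameter is at most `A exp (-θ k)` and their measure at least
`m q ^ k`. -/
structure IsTreeSystem (μ : Measure X) (ψ : (ℕ → Fin N) → ℕ → Set X) (f : (ℕ → Fin N) → X)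
    (A θ m q : ℝ) : Prop where
  mem : ∀ w k, f w ∈ ψ w k
  congr : ∀ w w' k, (∀ j < k, w j = w' j) → ψ w k = ψ w' k
  disjoint : ∀ w w' k, (∃ j < k, w j ≠ w' j) → Disjoint (ψ w k) (ψ w' k)
  dist_le : ∀ w k, ∀ x ∈ ψ w k, ∀ y ∈ ψ w k, dist x y ≤ A * Real.exp (-(θ * k))
  measurableSet : ∀ w k, MeasurableSet (ψ w k)
  le_measure : ∀ w k, ENNReal.ofReal (m * q ^ k) ≤ μ (ψ w k)

namespace IsTreeSystem
variable {μ : Measure X} {ψ : (ℕ → Fin N) → ℕ → Set X} {f : (ℕ → Fin N) → X} {A θ m q : ℝ}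

theorem continuous (h : IsTreeSystem μ ψ f A θ m q) (hθ : 0 < θ) : Continuous f := by
  refine continuous_iff_continuousAt.2 fun w => Metric.tendsto_nhds.2 fun ε hε => ?_
  have ht : Tendsto (fun k : ℕ => A * Real.exp (-(θ * k))) atTop (𝓝 0) := by
    have h1 : Tendsto (fun k : ℕ => θ * (k : ℝ)) atTop atTop :=
      tendsto_natCast_atTop_atTop.const_mul_atTop hθ
    simpa using (Real.tendsto_exp_neg_atTop_nhds_zero.comp h1).const_mul A
  obtain ⟨k, hk⟩ := (ht.eventually (gt_mem_nhds hε)).exists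
  have hev : ∀ᶠ w' in 𝓝 w, ∀ j ∈ Finset.range k, w' j = w j := by
    refine (Finset.eventually_all _).2 fun j _ => ?_
    have : {w j} ∈ 𝓝 (w j) := (isOpen_discrete _).mem_nhds rfl
    exact (continuous_apply j).continuousAt.eventually this
  filter_upwards [hev] with w' hw'
  refine (h.dist_le w k _ ?_ _ (h.mem w k)).trans_lt hk
  rw [← h.congr w' w k fun j hj => hw' j (Finset.mem_range.2 hj)]
  exact h.mem w' k

/-- The level-`k` sets whose branches meet `E` are disjoint, lie in one ball of radius `2 * ρ` and
have measure at least `m * q ^ k`. This bounds their number, and each cylinder has mass `N⁻ᵏ`. -/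
theorem measure_preimage_le [NeZero N] (h : IsTreeSystem μ ψ f A θ m q) (hm : 0 < m) (hq : 0 < q)
    {E : Set X} {ρ b : ℝ} (hb : 0 ≤ b) (hE : ∀ x ∈ E, ∀ y ∈ E, dist x y ≤ ρ)
    (hμ : ∀ x, μ (Metric.closedBall x (2 * ρ)) ≤ ENNReal.ofReal b)
    (k : ℕ) (hk : A * Real.exp (-(θ * k)) ≤ ρ) :
    infinitePi (fun _ : ℕ => (PMF.uniformOfFintype (Fin N)).toMeasure) (f ⁻¹' E) ≤
      ENNReal.ofReal (b / (m * (q * N) ^ k)) := by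
  classical
  have hN : 0 < (N : ℝ) := by exact_mod_cast Nat.pos_of_ne_zero (NeZero.ne N)
  rcases (f ⁻¹' E).eq_empty_or_nonempty with he | ⟨w₀, hw₀⟩
  · simp [he]
  -- The padding value is irrelevant, since level-`k` sets depend on the first `k` entries only.
  let ext : (Fin k → Fin N) → ℕ → Fin N := fun v j => if hj : j < k then v ⟨j, hj⟩ else 0
  have hext : ∀ v (i : Fin k), ext v i = v i := fun v i => by simp [ext]
  let F : Finset (Fin k → Fin N) :=
    Finset.univ.filter fun v => ∃ w, (∀ i : Fin k, w i = v i) ∧ f w ∈ E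
  have hcongr : ∀ v w, (∀ i : Fin k, w i = v i) → ψ w k = ψ (ext v) k := fun v w hw =>
    h.congr _ _ _ fun j hj => (hw ⟨j, hj⟩).trans (hext v ⟨j, hj⟩).symm
  have hsub : ∀ v ∈ F, ψ (ext v) k ⊆ Metric.closedBall (f w₀) (2 * ρ) := by
    intro v hv x hx
    obtain ⟨w, hw, hwE⟩ := (Finset.mem_filter.1 hv).2
    rw [← hcongr v w hw] at hx
    have h1 := (h.dist_le w k x hx _ (h.mem w k)).trans hk
    have h2 := hE _ hwE _ hw₀
    rw [Metric.mem_closedBall]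
    linarith [dist_triangle x (f w) (f w₀)]
  have hdisj : (F : Set (Fin k → Fin N)).PairwiseDisjoint fun v => ψ (ext v) k := by
    intro v _ v' _ hne
    obtain ⟨i, hi⟩ := Function.ne_iff.1 hne
    exact h.disjoint _ _ _ ⟨i, i.2, by rwa [hext, hext]⟩
  have hcount : (F.card : ℝ) * (m * q ^ k) ≤ b := by
    have h1 : (F.card : ℝ≥0∞) * ENNReal.ofReal (m * q ^ k) ≤ ENNReal.ofReal b := by
      calc (F.card : ℝ≥0∞) * ENNReal.ofReal (m * q ^ k)
          = ∑ v ∈ F, ENNReal.ofReal (m * q ^ k) := by simp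
        _ ≤ ∑ v ∈ F, μ (ψ (ext v) k) := Finset.sum_le_sum fun v _ => h.le_measure _ _
        _ = μ (⋃ v ∈ F, ψ (ext v) k) :=
          (measure_biUnion_finset hdisj fun v _ => h.measurableSet _ _).symm
        _ ≤ μ (Metric.closedBall (f w₀) (2 * ρ)) := measure_mono (iUnion₂_subset hsub)
        _ ≤ ENNReal.ofReal b := hμ _
    rw [← ENNReal.ofReal_natCast, ← ENNReal.ofReal_mul (by positivity)] at h1
    exact (ENNReal.ofReal_le_ofReal_iff hb).1 h1
  have hcover : f ⁻¹' E ⊆ ⋃ v ∈ F, {w : ℕ → Fin N | ∀ i : Fin k, w i = v i} := by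
    intro w hw
    exact mem_iUnion₂.2 ⟨fun i => w i,
      Finset.mem_filter.2 ⟨Finset.mem_univ _, w, fun _ => rfl, hw⟩, fun _ => rfl⟩
  calc _ ≤ infinitePi (fun _ : ℕ => (PMF.uniformOfFintype (Fin N)).toMeasure)
        (⋃ v ∈ F, {w : ℕ → Fin N | ∀ i : Fin k, w i = v i}) := measure_mono hcover
    _ ≤ ∑ v ∈ F, ((N : ℝ≥0∞)⁻¹) ^ k := (measure_biUnion_finset_le _ _).trans_eq
        (Finset.sum_congr rfl fun v _ => infinitePi_uniform_cylinder N k v)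
    _ = ENNReal.ofReal (F.card * ((N : ℝ)⁻¹) ^ k) := by
        rw [ENNReal.ofReal_mul (by positivity), ENNReal.ofReal_pow (by positivity),
          ENNReal.ofReal_inv_of_pos hN]
        simp
    _ ≤ _ := by
        apply ENNReal.ofReal_le_ofReal
        rw [le_div_iff₀ (by positivity), mul_pow]
        calc (F.card : ℝ) * ((N : ℝ)⁻¹) ^ k * (m * (q ^ k * (N : ℝ) ^ k))
            = (F.card * (m * q ^ k)) * ((N : ℝ)⁻¹ * N) ^ k := by rw [mul_pow]; ring
          _ ≤ b := by rw [inv_mul_cancel₀ hN.ne']; simpa using hcount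

theorem le_dimH_range [BorelSpace X] [NeZero N] (h : IsTreeSystem μ ψ f A θ m q) (hA : 0 < A) (hθ : 0 < θ) (hm : 0 < m)
    (hq : 0 < q) {B r : ℝ} {n : ℕ} (hB : 0 < B) (hr : 0 < r)
    (hμ : ∀ ρ, 0 < ρ → ρ < r → ∀ x, μ (Metric.closedBall x ρ) ≤ ENNReal.ofReal (B * ρ ^ n))
    {s : ℝ≥0} (hsn : s ≤ n) (hqN : Real.exp (-(θ * (n - s))) ≤ q * N) :
    (s : ℝ≥0∞) ≤ dimH (range f) := by
  have hN : 0 < (N : ℝ) := by exact_mod_cast Nat.pos_of_ne_zero (NeZero.ne N)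
  set ν := infinitePi (fun _ : ℕ => (PMF.uniformOfFintype (Fin N)).toMeasure) with hν
  have hfc := h.continuous hθ
  have hns : 0 ≤ (n : ℝ) - s := sub_nonneg.2 (by exact_mod_cast hsn)
  set K : ℝ := B * 2 ^ n / m * Real.exp (θ * (n - s)) * A ^ ((n : ℝ) - s) with hK
  have hK0 : 0 < K := by positivity
  set ρ₀ := min (r / 4) A with hρ₀
  have hρ₀0 : 0 < ρ₀ := by positivity
  have key : ∀ ρ, 0 < ρ → ρ ≤ ρ₀ → ∀ E : Set X, (∀ x ∈ E, ∀ y ∈ E, dist x y ≤ ρ) →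
      ν (f ⁻¹' E) ≤ ENNReal.ofReal (K * ρ ^ (s : ℝ)) := by
    intro ρ hρ hρle E hE
    have hρA : ρ ≤ A := hρle.trans (min_le_right _ _)
    have hρr : ρ ≤ r / 4 := hρle.trans (min_le_left _ _)
    have hl0 : 0 ≤ Real.log (A / ρ) := Real.log_nonneg ((one_le_div hρ).2 hρA)
    -- The first level at which the diameter bound drops to `ρ`; then `exp (-θ k)` is comparable to
    -- `ρ / A`, and `hqN` bounds `(q * N) ^ k` below by a multiple of `ρ ^ (n - s)`.
    set k := ⌈Real.log (A / ρ) / θ⌉₊ with hk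
    have hk1 : Real.log (A / ρ) ≤ θ * k := by
      rw [mul_comm, ← div_le_iff₀ hθ]; exact Nat.le_ceil _
    have hk2 : θ * k ≤ Real.log (A / ρ) + θ := by
      have h1 := (Nat.ceil_lt_add_one (div_nonneg hl0 hθ.le)).le
      calc θ * k ≤ θ * (Real.log (A / ρ) / θ + 1) := by gcongr
        _ = _ := by field_simp
    have hkρ : A * Real.exp (-(θ * k)) ≤ ρ := by
      calc A * Real.exp (-(θ * k)) ≤ A * Real.exp (-Real.log (A / ρ)) := by gcongr
        _ = ρ := by
          rw [Real.exp_neg, Real.exp_log (by positivity)]; field_simp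
    refine (h.measure_preimage_le hm hq (b := B * (2 * ρ) ^ n) (by positivity) hE
      (hμ (2 * ρ) (by positivity) (by linarith)) k hkρ).trans (ENNReal.ofReal_le_ofReal ?_)
    have h1 : Real.exp (-((n - s) * (θ * k))) ≤ (q * N) ^ k := by
      calc Real.exp (-((n - s) * (θ * k))) = Real.exp (-(θ * (n - s))) ^ k := by
            rw [← Real.exp_nat_mul]; congr 1; ring
        _ ≤ (q * N) ^ k := by gcongr
    have h2 : Real.exp ((n - s) * (θ * k)) ≤
        Real.exp (θ * (n - s)) * (A ^ ((n : ℝ) - s) / ρ ^ ((n : ℝ) - s)) := by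
      rw [← Real.div_rpow hA.le hρ.le, Real.rpow_def_of_pos (by positivity), ← Real.exp_add]
      apply Real.exp_le_exp.2
      nlinarith
    calc B * (2 * ρ) ^ n / (m * (q * N) ^ k)
        ≤ B * (2 * ρ) ^ n / (m * Real.exp (-((n - s) * (θ * k)))) := by gcongr
      _ = B * 2 ^ n / m * ρ ^ n * Real.exp ((n - s) * (θ * k)) := by
          rw [Real.exp_neg, mul_pow]; field_simp
      _ ≤ B * 2 ^ n / m * ρ ^ n *
          (Real.exp (θ * (n - s)) * (A ^ ((n : ℝ) - s) / ρ ^ ((n : ℝ) - s))) := by gcongr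
      _ = K * (ρ ^ n / ρ ^ ((n : ℝ) - s)) := by rw [hK]; ring
      _ = K * ρ ^ (s : ℝ) := by
          rw [← Real.rpow_natCast, ← Real.rpow_sub hρ]; congr 2; ring
  have hle : (ENNReal.ofReal K)⁻¹ • ν.map f ≤ μH[s] := by
    refine le_hausdorffMeasure _ _ (ENNReal.ofReal ρ₀) (by simpa using hρ₀0) fun E hE => ?_
    have hEt : Metric.ediam E ≠ ⊤ := (hE.trans_lt ENNReal.ofReal_lt_top).ne
    set D := (Metric.ediam E).toReal with hD
    have hD0 : 0 ≤ D := ENNReal.toReal_nonneg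
    have hDρ : D ≤ ρ₀ := ENNReal.toReal_le_of_le_ofReal hρ₀0.le hE
    have hdist : ∀ x ∈ closure E, ∀ y ∈ closure E, dist x y ≤ D := by
      intro x hx y hy
      have hcl : Metric.ediam (closure E) = Metric.ediam E := Metric.ediam_closure E
      rw [hD, ← hcl]
      exact Metric.dist_le_diam_of_mem' (by rwa [hcl]) hx hy
    have h1 : ν.map f E ≤ ν (f ⁻¹' closure E) := by
      rw [← Measure.map_apply hfc.measurable isClosed_closure.measurableSet]
      exact measure_mono subset_closure
    have h2 : ν (f ⁻¹' closure E) ≤ ENNReal.ofReal (K * D ^ (s : ℝ)) := by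
      -- `key` needs a positive radius, so sets of diameter zero are treated by letting `ρ` decrease
      -- to `0`; this also covers `s = 0`.
      rcases hD0.eq_or_lt with h0 | h0
      · have hlim : Tendsto (fun ρ : ℝ => ENNReal.ofReal (K * ρ ^ (s : ℝ))) (𝓝[>] D)
            (𝓝 (ENNReal.ofReal (K * D ^ (s : ℝ)))) := by
          have : Continuous fun ρ : ℝ => ENNReal.ofReal (K * ρ ^ (s : ℝ)) :=
            ENNReal.continuous_ofReal.comp
              (continuous_const.mul (Real.continuous_rpow_const s.coe_nonneg))
          exact this.continuousAt.tendsto.mono_left nhdsWithin_le_nhds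
        refine ge_of_tendsto hlim ?_
        rw [← h0]
        filter_upwards [Ioc_mem_nhdsGT hρ₀0] with ρ hρ
        exact key ρ hρ.1 hρ.2 _ fun x hx y hy => (hdist x hx y hy).trans (h0 ▸ hρ.1.le)
      · exact key D h0 hDρ _ hdist
    rw [Measure.smul_apply, smul_eq_mul]
    calc (ENNReal.ofReal K)⁻¹ * ν.map f E
        ≤ (ENNReal.ofReal K)⁻¹ * ENNReal.ofReal (K * D ^ (s : ℝ)) := by
          gcongr; exact h1.trans h2
      _ = ENNReal.ofReal (D ^ (s : ℝ)) := by
          rw [ENNReal.ofReal_mul hK0.le, ← mul_assoc, ENNReal.inv_mul_cancel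
            (by simpa using hK0) ENNReal.ofReal_ne_top, one_mul]
      _ = Metric.ediam E ^ (s : ℝ) := by
          rw [← ENNReal.ofReal_rpow_of_nonneg hD0 s.coe_nonneg, hD, ENNReal.ofReal_toReal hEt]
  refine le_dimH_of_hausdorffMeasure_ne_zero fun h0 => ?_
  have h1 := hle (range f)
  rw [h0, Measure.smul_apply, smul_eq_mul, Measure.map_apply hfc.measurable
    (isCompact_range hfc).measurableSet, preimage_range, measure_univ, mul_one] at h1
  exact (ENNReal.inv_pos.2 ENNReal.ofReal_ne_top).not_ge h1

end IsTreeSystem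
end Tree

namespace ModifiedSchmidt
open MeasureTheory Measure
open scoped ENNReal NNReal Pointwise

/-! ### Self-similarity of the game and packing of translates. -/

section InducedPsi
variable {H : Type*} [Group H] [TopologicalSpace H] {Φ : ℝ → H ≃ₜ* H} {D₀ : Set H}

theorem inducedPsi_eq_image (Φ : ℝ → H ≃ₜ* H) (D₀ : Set H) (x : H) (t : ℝ) :
    inducedPsi Φ D₀ (x, t) = (fun g => g * x) '' (Φ t '' D₀) := by
  rw [image_image]; rfl

/-- Self-similarity: inclusions and disjointness checked once inside `D₀` transfer to every
position. -/
theorem IsContractingOneParameterGroup.inducedPsi_add (hΦ : IsContractingOneParameterGroup Φ)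
    (D₀ : Set H) (x y : H) (t s : ℝ) :
    inducedPsi Φ D₀ (Φ t y * x, t + s) = (fun g => Φ t g * x) '' inducedPsi Φ D₀ (y, s) := by
  rw [inducedPsi, inducedPsi, image_image]
  refine image_congr fun g _ => ?_
  simp only [map_mul, hΦ.map_add, mul_assoc]

theorem IsContractingOneParameterGroup.inducedLE_of_subset
    (hΦ : IsContractingOneParameterGroup Φ) {y : H} {s : ℝ}
    (h : inducedPsi Φ D₀ (y, s) ⊆ D₀) (x : H) (t : ℝ) :
    inducedLE Φ D₀ (Φ t y * x, t + s) (x, t) := by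
  rw [inducedLE, hΦ.inducedPsi_add]
  exact image_mono h

theorem IsContractingOneParameterGroup.disjoint_inducedPsi_add
    (hΦ : IsContractingOneParameterGroup Φ) {y y' : H} {s : ℝ}
    (h : Disjoint (inducedPsi Φ D₀ (y, s)) (inducedPsi Φ D₀ (y', s))) (x : H) (t : ℝ) :
    Disjoint (inducedPsi Φ D₀ (Φ t y * x, t + s)) (inducedPsi Φ D₀ (Φ t y' * x, t + s)) := by
  rw [hΦ.inducedPsi_add, hΦ.inducedPsi_add]
  exact disjoint_image_of_injective
    (fun a b hab => (Φ t).injective (mul_right_cancel hab)) h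

variable [IsTopologicalGroup H]

theorem isCompact_inducedPsi (hD₀ : IsCompact D₀) (p : H × ℝ) :
    IsCompact (inducedPsi Φ D₀ p) :=
  hD₀.image (((Φ p.2).continuous).mul continuous_const)

/-- `Φ s (D₀)` shrinks uniformly to `1`, so its translates by points near an interior point `z` of
`D₀` stay in `D₀`. -/
theorem IsAdmissible.exists_packing_nhds [BaireSpace H]
    (hΦ : IsContractingOneParameterGroup Φ) (hD₀ : IsAdmissible D₀) :
    ∃ O : Set H, IsOpen O ∧ O.Nonempty ∧ ∃ T : ℝ, 0 ≤ T ∧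
      ∀ s, T ≤ s → ∀ y ∈ O, inducedPsi Φ D₀ (y, s) ⊆ D₀ := by
  obtain ⟨hc, z, hz⟩ := hD₀
  have hW : (fun w => w * z) ⁻¹' interior D₀ ∈ 𝓝 (1 : H) :=
    (isOpen_interior.preimage (continuous_mul_const z)).mem_nhds (by simpa using hz)
  obtain ⟨V, hVo, hV1, hVV⟩ := exists_open_nhds_one_mul_subset hW
  obtain ⟨T, hT0, hT⟩ := hΦ.exists_forall_mem hc (hVo.mem_nhds hV1)
  refine ⟨(fun y => y * z⁻¹) ⁻¹' V, hVo.preimage (continuous_mul_const _), ⟨z, by simpa using hV1⟩,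
    T, hT0, ?_⟩
  rintro s hs y hy _ ⟨g, hg, rfl⟩
  have h1 : Φ s g * (y * z⁻¹) * z ∈ interior D₀ := hVV (mul_mem_mul (hT s hs g hg) hy)
  rw [mul_assoc, inv_mul_cancel_right] at h1
  exact interior_subset h1

theorem IsAdmissible.exists_msg0 [BaireSpace H]
    (hΦ : IsContractingOneParameterGroup Φ) (hD₀ : IsAdmissible D₀) :
    ∃ aStar : ℝ, 0 ≤ aStar ∧ MSG0 (inducedLE Φ D₀) aStar := by
  obtain ⟨O, -, ⟨y, hy⟩, T, hT0, hT⟩ := hD₀.exists_packing_nhds hΦ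
  exact ⟨T, hT0, fun x t s hs =>
    ⟨Φ t y * x, hΦ.inducedLE_of_subset (hT s hs.le y hy) x t⟩⟩

variable [MeasurableSpace H] [BorelSpace H]

theorem measure_inducedPsi (μ : Measure H) [IsMulRightInvariant μ] (A : Set H) (x : H) (t : ℝ) :
    μ (inducedPsi Φ A (x, t)) = μ (Φ t '' A) := by
  rw [inducedPsi_eq_image, image_mul_right, measure_preimage_mul_right]

/-- For large `b`, about `c / Δ` disjoint right translates of `Φ_b(D₀)` fit into `D₀`, where `Δ` is
the modulus of `Φ_b`. -/
theorem IsAdmissible.exists_packing [T2Space H] [BaireSpace H]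
    (μ : Measure H) [IsMulRightInvariant μ] [IsFiniteMeasureOnCompacts μ] [IsOpenPosMeasure μ]
    (hΦ : IsContractingOneParameterGroup Φ) (hD₀ : IsAdmissible D₀) :
    ∃ c : ℝ≥0∞, c ≠ 0 ∧ ∃ T : ℝ, 0 ≤ T ∧ ∀ b, T ≤ b → ∀ Δ : ℝ≥0∞, Δ ≠ 0 →
      (∀ A, μ (Φ b '' A) = Δ * μ A) → ∃ s : Finset H,
        (∀ y ∈ s, inducedPsi Φ D₀ (y, b) ⊆ D₀) ∧
        ((s : Set H).PairwiseDisjoint fun y => inducedPsi Φ D₀ (y, b)) ∧ c ≤ s.card * Δ := by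
  obtain ⟨O, hO, hOne, T, hT0, hT⟩ := hD₀.exists_packing_nhds hΦ
  have hcpt : IsCompact (D₀⁻¹ * D₀) := hD₀.1.inv.mul hD₀.1
  have hfin : μ (D₀⁻¹ * D₀) ≠ ⊤ := hcpt.measure_lt_top.ne
  have hDpos : μ D₀ ≠ 0 := fun h0 =>
    isOpen_interior.measure_ne_zero μ hD₀.2 (measure_mono_null interior_subset h0)
  have hDfin : μ D₀ ≠ ⊤ := hD₀.1.measure_lt_top.ne
  refine ⟨μ O / μ (D₀⁻¹ * D₀), (ENNReal.div_pos (hO.measure_ne_zero μ hOne) hfin).ne', T, hT0,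
    fun b hb Δ hΔ hscale => ?_⟩
  -- A disjoint family with centres in `O` and of maximal size is wanted; comparison of measures
  -- inside `D₀` bounds the size.
  let P : Set ℕ := {k | ∃ s : Finset H, s.card = k ∧ (s : Set H) ⊆ O ∧
    (s : Set H).PairwiseDisjoint fun y => inducedPsi Φ D₀ (y, b)}
  have hP0 : P.Nonempty := ⟨0, ∅, by simp⟩
  have hPb : BddAbove P := by
    refine ⟨⌈(μ D₀ / (Δ * μ D₀)).toReal⌉₊, ?_⟩
    rintro _ ⟨s, rfl, hsO, hs⟩
    have h1 : (s.card : ℝ≥0∞) * (Δ * μ D₀) ≤ μ D₀ := by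
      calc (s.card : ℝ≥0∞) * (Δ * μ D₀) = ∑ y ∈ s, μ (inducedPsi Φ D₀ (y, b)) := by
            simp [measure_inducedPsi, hscale]
        _ = μ (⋃ y ∈ s, inducedPsi Φ D₀ (y, b)) :=
            (measure_biUnion_finset hs
              fun y _ => (isCompact_inducedPsi hD₀.1 _).measurableSet).symm
        _ ≤ μ D₀ := measure_mono (iUnion₂_subset fun y hy => hT b hb y (hsO hy))
    have hne : Δ * μ D₀ ≠ 0 := mul_ne_zero hΔ hDpos
    have h2 : (s.card : ℝ≥0∞) ≤ μ D₀ / (Δ * μ D₀) :=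
      ENNReal.le_div_iff_mul_le (Or.inl hne) (Or.inr hDfin) |>.2 h1
    have h3 := ENNReal.toReal_mono (ENNReal.div_ne_top hDfin hne) h2
    rw [ENNReal.toReal_natCast] at h3
    exact_mod_cast h3.trans (Nat.le_ceil _)
  obtain ⟨s, hcard, hsO, hs⟩ := Nat.sSup_mem hP0 hPb
  refine ⟨s, fun y hy => hT b hb y (hsO hy), hs, ?_⟩
  have hDne : D₀.Nonempty := hD₀.2.mono interior_subset
  -- By maximality the translate at any `y ∈ O` meets one at some `y' ∈ s`, and `Φ b g * y = Φ b h *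
  -- y'` means `y = Φ b (g⁻¹ * h) * y'`.
  have hcover : O ⊆ ⋃ y ∈ s, inducedPsi Φ (D₀⁻¹ * D₀) (y, b) := by
    intro y hy
    by_contra hcon
    have hdis : ∀ y' ∈ s, Disjoint (inducedPsi Φ D₀ (y, b)) (inducedPsi Φ D₀ (y', b)) := by
      intro y' hy'
      refine Set.disjoint_left.2 ?_
      rintro _ ⟨g, hg, rfl⟩ ⟨h, hh, hgh⟩
      refine hcon (mem_iUnion₂.2 ⟨y', hy', g⁻¹ * h, mul_mem_mul (by simpa using hg) hh, ?_⟩)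
      simp only [map_mul, map_inv] at hgh ⊢
      rw [mul_assoc, hgh, inv_mul_cancel_left]
    have hys : y ∉ s := fun hys => by
      have := hdis y hys
      rw [disjoint_self] at this
      exact (hDne.image _).ne_empty this
    classical
    have hmem : s.card + 1 ∈ P := by
      refine ⟨insert y s, Finset.card_insert_of_notMem hys, ?_, ?_⟩
      · rw [Finset.coe_insert]; exact insert_subset hy hsO
      · rw [Finset.coe_insert]
        exact hs.insert fun y' hy' _ => hdis y' hy'
    have := le_csSup hPb hmem
    omega
  refine ENNReal.div_le_of_le_mul ?_
  calc μ O ≤ μ (⋃ y ∈ s, inducedPsi Φ (D₀⁻¹ * D₀) (y, b)) := measure_mono hcover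
    _ ≤ ∑ y ∈ s, μ (inducedPsi Φ (D₀⁻¹ * D₀) (y, b)) := measure_biUnion_finset_le _ _
    _ = s.card * Δ * μ (D₀⁻¹ * D₀) := by simp [measure_inducedPsi, hscale, mul_assoc]

end InducedPsi

/-! ### Bob's plays along the branches of a tree. -/

section Play

theorem exists_seq_of_history {E : Type*} (x₀ : E) (step : (k : ℕ) → (Fin (k + 1) → E) → E) :
    ∃ p : ℕ → E, p 0 = x₀ ∧ ∀ k, p (k + 1) = step k fun i => p i := by
  -- `h n` is already correct up to index `n`, and later stages never alter those entries; the play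
  -- is the diagonal.
  let h : ℕ → ℕ → E := fun n => Nat.rec (fun _ => x₀)
    (fun k g => Function.update g (k + 1) (step k fun i => g i)) n
  have hs : ∀ k, h (k + 1) = Function.update (h k) (k + 1) (step k fun i => h k i) := fun k => rfl
  have hstab : ∀ k j, j ≤ k → h k j = h j j := by
    intro k
    induction k with
    | zero => intro j hj; rw [Nat.le_zero.1 hj]
    | succ k ih =>
      intro j hj
      rcases hj.eq_or_lt with rfl | hlt
      · rfl
      · rw [hs, Function.update_of_ne hlt.ne, ih j (by omega)]
  refine ⟨fun k => h k k, rfl, fun k => ?_⟩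
  simp only [hs, Function.update_self]
  congr 1
  funext i
  exact hstab k i (by omega)

variable {H : Type*} [Group H] [TopologicalSpace H] {Φ : ℝ → H ≃ₜ* H} {D₀ : Set H} {N : ℕ}

/-- Bob's moves along the branch `w`: at stage `k` he answers Alice by the `w k`-th of the sets
`ψ (y i, b)`, transported into the set that she chose. -/
def IsBranchPlay (Φ : ℝ → H ≃ₜ* H) (σ : Strategy H) (a b : ℝ) (y : Fin N → H) (p₀ : H × ℝ)
    (w : ℕ → Fin N) (p : ℕ → H × ℝ) : Prop :=
  p 0 = p₀ ∧ ∀ k, p (k + 1) = (Φ (aliceMove σ a p k).2 (y (w k)) * (aliceMove σ a p k).1,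
    (aliceMove σ a p k).2 + b)

variable {σ : Strategy H} {a b : ℝ} {y : Fin N → H} {p₀ : H × ℝ}

theorem exists_isBranchPlay (Φ : ℝ → H ≃ₜ* H) (σ : Strategy H) (a b : ℝ) (y : Fin N → H)
    (p₀ : H × ℝ) (w : ℕ → Fin N) : ∃ p, IsBranchPlay Φ σ a b y p₀ w p := by
  obtain ⟨p, h0, hp⟩ := exists_seq_of_history p₀ fun k (h : Fin (k + 1) → H × ℝ) =>
    (Φ ((h (Fin.last k)).2 + a) (y (w k)) * σ k h, (h (Fin.last k)).2 + a + b)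
  exact ⟨p, h0, hp⟩

namespace IsBranchPlay

variable {w w' : ℕ → Fin N} {p p' : ℕ → H × ℝ}

theorem snd_eq (h : IsBranchPlay Φ σ a b y p₀ w p) (k : ℕ) : (p k).2 = p₀.2 + k * (a + b) := by
  induction k with
  | zero => simp [h.1]
  | succ k ih =>
    rw [h.2 k]
    simp only [aliceMove, ih]
    push_cast
    ring

theorem congr (h : IsBranchPlay Φ σ a b y p₀ w p) (h' : IsBranchPlay Φ σ a b y p₀ w' p') {k : ℕ}
    (hk : ∀ j < k, w j = w' j) : ∀ i ≤ k, p i = p' i := by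
  induction k with
  | zero => intro i hi; rw [Nat.le_zero.1 hi, h.1, h'.1]
  | succ k ih =>
    have ih := ih fun j hj => hk j (by omega)
    intro i hi
    rcases hi.eq_or_lt with rfl | hlt
    · have hm : aliceMove σ a p k = aliceMove σ a p' k := by
        simp only [aliceMove, ih k le_rfl]
        congr 2
        funext i
        exact ih i (by omega)
      rw [h.2, h'.2, hm, hk k (by omega)]
    · exact ih i (by omega)

theorem bobLegal (h : IsBranchPlay Φ σ a b y p₀ w p) (hΦ : IsContractingOneParameterGroup Φ)
    (hy : ∀ i, inducedPsi Φ D₀ (y i, b) ⊆ D₀) (k : ℕ) :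
    BobLegal (inducedLE Φ D₀) σ a b p k := by
  refine ⟨by rw [h.2], ?_⟩
  rw [h.2]
  exact hΦ.inducedLE_of_subset (hy (w k)) _ _

theorem antitone (h : IsBranchPlay Φ σ a b y p₀ w p) (hΦ : IsContractingOneParameterGroup Φ)
    (hy : ∀ i, inducedPsi Φ D₀ (y i, b) ⊆ D₀)
    (hσ : ∀ n : ℕ, (∀ k < n, BobLegal (inducedLE Φ D₀) σ a b p k) →
      inducedLE Φ D₀ (aliceMove σ a p n) (p n)) :
    Antitone fun k => inducedPsi Φ D₀ (p k) :=
  antitone_nat_of_succ_le fun k =>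
    (h.bobLegal hΦ hy k).2.trans (hσ k fun j _ => h.bobLegal hΦ hy j)

/-- At the first index where the branches differ, Alice has seen the same history and moves
identically, so Bob's answers are disjoint; nesting propagates this to later levels. -/
theorem disjoint (h : IsBranchPlay Φ σ a b y p₀ w p) (h' : IsBranchPlay Φ σ a b y p₀ w' p')
    (hΦ : IsContractingOneParameterGroup Φ)
    (hdis : ∀ i j, i ≠ j → Disjoint (inducedPsi Φ D₀ (y i, b)) (inducedPsi Φ D₀ (y j, b)))
    (hanti : Antitone fun k => inducedPsi Φ D₀ (p k))
    (hanti' : Antitone fun k => inducedPsi Φ D₀ (p' k))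
    {k : ℕ} (hk : ∃ j < k, w j ≠ w' j) :
    Disjoint (inducedPsi Φ D₀ (p k)) (inducedPsi Φ D₀ (p' k)) := by
  classical
  have hex : ∃ j, w j ≠ w' j := hk.imp fun _ hj => hj.2
  set m := Nat.find hex with hm
  have hmk : m + 1 ≤ k := by
    obtain ⟨j, hj, hne⟩ := hk
    have := Nat.find_le (h := hex) hne
    omega
  have heq : ∀ j < m, w j = w' j := fun j hj => not_not.1 (Nat.find_min hex hj)
  have hp := h.congr h' heq
  have hal : aliceMove σ a p m = aliceMove σ a p' m := by
    simp only [aliceMove, hp m le_rfl]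
    congr 2
    funext i
    exact hp i (by omega)
  refine Disjoint.mono (hanti hmk) (hanti' hmk) ?_
  simp only [h.2 m, h'.2 m, hal]
  exact hΦ.disjoint_inducedPsi_add (hdis _ _ (Nat.find_spec hex)) _ _

end IsBranchPlay
end Play

/-! ### The lower bound for the dimension of a winning set. -/

section Thick

variable {H : Type*} [MetricSpace H] [Group H] [IsIsometricSMul Hᵐᵒᵖ H] {Φ : ℝ → H ≃ₜ* H} {D₀ : Set H}

theorem dist_le_of_mem_inducedPsi {σ B : ℝ}
    (hB : ∀ t, 0 ≤ t → ∀ g ∈ D₀, dist (Φ t g) 1 ≤ B * Real.exp (-σ * t)) {x : H} {t : ℝ}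
    (ht : 0 ≤ t) {u v : H} (hu : u ∈ inducedPsi Φ D₀ (x, t)) (hv : v ∈ inducedPsi Φ D₀ (x, t)) :
    dist u v ≤ 2 * B * Real.exp (-σ * t) := by
  obtain ⟨g, hg, rfl⟩ := hu
  obtain ⟨h, hh, rfl⟩ := hv
  rw [dist_mul_right]
  have := dist_triangle_right (Φ t g) (Φ t h) 1
  linarith [hB t ht g hg, hB t ht h hh]

theorem IsWinning.le_dimH_inter [IsTopologicalGroup H] [LocallyCompactSpace H]
    [MeasurableSpace H] [BorelSpace H] (hΦ : IsContractingOneParameterGroup Φ) (hD₀ : IsAdmissible D₀)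
    {σ B₀ : ℝ} (hσ : 0 < σ) (hB₀ : 0 < B₀)
    (hexp : ∀ t, 0 ≤ t → ∀ g ∈ D₀, dist (Φ t g) 1 ≤ B₀ * Real.exp (-σ * t))
    (μ : Measure H) [IsMulRightInvariant μ] [Regular μ] [IsOpenPosMeasure μ]
    {B r : ℝ} {n : ℕ} (hB : 0 < B) (hr : 0 < r)
    (hμ : ∀ ρ, 0 < ρ → ρ < r → ∀ x, μ (Metric.closedBall x ρ) ≤ ENNReal.ofReal (B * ρ ^ n))
    {aStar : ℝ} (haStar : 0 ≤ aStar) {S : Set H}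
    (hS : IsWinning (inducedLE Φ D₀) (inducedPsi Φ D₀) aStar S)
    {U : Set H} (hU : IsOpen U) (hUne : U.Nonempty) {s : ℝ≥0} (hs : s < n) :
    (s : ℝ≥0∞) ≤ dimH (S ∩ U) := by
  have hDpos : μ D₀ ≠ 0 := fun h0 =>
    isOpen_interior.measure_ne_zero μ hD₀.2 (measure_mono_null interior_subset h0)
  have hDfin : μ D₀ ≠ ⊤ := hD₀.1.measure_lt_top.ne
  choose Δ hΔ0 hΔt hΔ using fun t => exists_measure_image_eq_mul μ (Φ t)
  have hΔadd : ∀ s t, Δ (s + t) = Δ s * Δ t := fun s t => by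
    have h1 : Φ (s + t) '' D₀ = Φ s '' (Φ t '' D₀) := by
      rw [image_image]; exact image_congr fun g _ => hΦ.map_add s t g
    have h2 := hΔ (s + t) D₀
    rw [h1, hΔ, hΔ, ← mul_assoc] at h2
    exact ((ENNReal.mul_left_inj hDpos hDfin).1 h2).symm
  obtain ⟨a, ha, hwin⟩ := hS
  obtain ⟨c, hc, T, hT0, hpack⟩ := hD₀.exists_packing μ hΦ
  have hns : 0 < (n : ℝ) - s := sub_pos.2 (by exact_mod_cast hs)
  -- choose `b`
  have hlim : Tendsto (fun b : ℝ => ENNReal.ofReal (Real.exp (-(σ * (a + b) * (n - s))))) atTop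
      (𝓝 0) := by
    have h1 : Tendsto (fun b : ℝ => σ * (a + b) * (n - s)) atTop atTop :=
      ((tendsto_atTop_add_const_left atTop a tendsto_id).const_mul_atTop hσ).atTop_mul_const hns
    have h2 := Real.tendsto_exp_neg_atTop_nhds_zero.comp h1
    simpa using ENNReal.tendsto_ofReal h2
  have hcΔ : 0 < c * Δ a := pos_iff_ne_zero.2 (mul_ne_zero hc (hΔ0 a))
  obtain ⟨b, ⟨hbexp, hbT⟩, hbs⟩ := (((hlim.eventually (gt_mem_nhds hcΔ)).and
    (eventually_ge_atTop T)).and (eventually_gt_atTop aStar)).exists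
  obtain ⟨F, hF, hFdis, hFc⟩ := hpack b hbT (Δ b) (hΔ0 b) (hΔ b)
  obtain ⟨strat, hstrat⟩ := hwin b hbs
  set N := F.card with hN
  have hN0 : N ≠ 0 := fun h => by
    rw [h, Nat.cast_zero, zero_mul] at hFc
    exact hc (le_zero_iff.1 hFc)
  have : NeZero N := ⟨hN0⟩
  let y : Fin N → H := fun i => (F.equivFin.symm i : H)
  have hy : ∀ i, inducedPsi Φ D₀ (y i, b) ⊆ D₀ := fun i => hF _ (F.equivFin.symm i).2
  have hydis : ∀ i j, i ≠ j →
      Disjoint (inducedPsi Φ D₀ (y i, b)) (inducedPsi Φ D₀ (y j, b)) := fun i j hij =>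
    hFdis (F.equivFin.symm i).2 (F.equivFin.symm j).2
      fun h => hij (F.equivFin.symm.injective (Subtype.ext h))
  -- Bob's first move
  obtain ⟨u, hu⟩ := hUne
  have hW : (fun g => g * u) ⁻¹' U ∈ 𝓝 (1 : H) :=
    (hU.preimage (continuous_mul_const u)).mem_nhds (by simpa using hu)
  obtain ⟨t₀, ht₀, ht₀'⟩ := hΦ.exists_forall_mem hD₀.1 hW
  have hstart : inducedPsi Φ D₀ (u, t₀) ⊆ U := by
    rintro _ ⟨g, hg, rfl⟩
    exact ht₀' t₀ le_rfl g hg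
  choose p hp using exists_isBranchPlay Φ strat a b y (u, t₀)
  have hanti : ∀ w, Antitone fun k => inducedPsi Φ D₀ (p w k) := fun w =>
    (hp w).antitone hΦ hy (hstrat (p w)).1
  have hsub : ∀ w, ⋂ k, inducedPsi Φ D₀ (p w k) ⊆ S ∩ U := fun w => by
    refine subset_inter ((hstrat (p w)).2 ((hp w).bobLegal hΦ hy)) ?_
    refine (iInter_subset _ 0).trans ?_
    rw [(hp w).1]
    exact hstart
  have hDne : D₀.Nonempty := hD₀.2.mono interior_subset
  have hne : ∀ w, (⋂ k, inducedPsi Φ D₀ (p w k)).Nonempty := fun w =>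
    IsCompact.nonempty_iInter_of_sequence_nonempty_isCompact_isClosed _
      (fun k => hanti w (Nat.le_succ k)) (fun k => hDne.image _)
      (isCompact_inducedPsi hD₀.1 _) fun k => (isCompact_inducedPsi hD₀.1 _).isClosed
  choose f hf using hne
  have ha0 : 0 < a := haStar.trans_lt ha
  have hb0 : 0 < b := haStar.trans_lt hbs
  set τ := a + b with hτ
  have hτ0 : 0 < τ := by positivity
  have hsnd : ∀ w k, p w k = ((p w k).1, t₀ + k * τ) := fun w k =>
    Prod.ext rfl ((hp w).snd_eq k)
  have hΔpow : ∀ k : ℕ, Δ (t₀ + k * τ) = Δ t₀ * Δ τ ^ k := by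
    intro k
    induction k with
    | zero => simp
    | succ k ih =>
      have : t₀ + (k + 1 : ℕ) * τ = (t₀ + k * τ) + τ := by push_cast; ring
      rw [this, hΔadd, ih, pow_succ, mul_assoc]
  have hmt : Δ t₀ * μ D₀ ≠ ⊤ := ENNReal.mul_ne_top (hΔt _) hDfin
  have htree : IsTreeSystem μ (fun w k => inducedPsi Φ D₀ (p w k)) f (2 * B₀) (σ * τ)
      (Δ t₀ * μ D₀).toReal (Δ τ).toReal :=
    { mem := fun w k => mem_iInter.1 (hf w) k
      congr := fun w w' k hk => by
        simp only [(hp w).congr (hp w') hk k le_rfl]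
      disjoint := fun w w' k hk =>
        (hp w).disjoint (hp w') hΦ hydis (hanti w) (hanti w') hk
      dist_le := fun w k x hx z hz => by
        have hmem : ∀ v ∈ inducedPsi Φ D₀ (p w k),
            v ∈ inducedPsi Φ D₀ ((p w k).1, t₀ + k * τ) := fun v hv => by
          rwa [← hsnd w k]
        -- The factor `exp (-σ t₀)` is at most `1` and is dropped.
        refine (dist_le_of_mem_inducedPsi hexp (by positivity) (hmem x hx) (hmem z hz)).trans ?_
        gcongr
        nlinarith
      measurableSet := fun w k => (isCompact_inducedPsi hD₀.1 _).measurableSet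
      le_measure := fun w k => by
        rw [hsnd w k, measure_inducedPsi, hΔ, hΔpow, ENNReal.ofReal_mul ENNReal.toReal_nonneg,
          ENNReal.ofReal_pow ENNReal.toReal_nonneg, ENNReal.ofReal_toReal hmt,
          ENNReal.ofReal_toReal (hΔt τ)]
        exact le_of_eq (by ring) }
  -- `Δ τ * N = Δ a * (Δ b * N) ≥ c * Δ a` no longer involves `b`, which is why a large `b`
  -- suffices.
  have hqN : Real.exp (-(σ * τ * (n - s))) ≤ (Δ τ).toReal * N := by
    have h1 : ENNReal.ofReal (Real.exp (-(σ * τ * (n - s)))) ≤ Δ τ * N := by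
      refine hbexp.le.trans ?_
      rw [hτ, hΔadd]
      calc c * Δ a ≤ (N * Δ b) * Δ a := by gcongr
        _ = Δ a * Δ b * N := by ring
    rw [← ENNReal.toReal_natCast N, ← ENNReal.toReal_mul]
    exact (ENNReal.ofReal_le_iff_le_toReal (ENNReal.mul_ne_top (hΔt τ)
      (ENNReal.natCast_ne_top N))).1 h1
  have hdim := htree.le_dimH_range (by positivity) (by positivity)
    (ENNReal.toReal_pos (mul_ne_zero (hΔ0 _) hDpos) hmt) (ENNReal.toReal_pos (hΔ0 τ) (hΔt τ))
    hB hr hμ hs.le hqN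
  refine hdim.trans (dimH_mono ?_)
  rintro _ ⟨w, rfl⟩
  exact hsub w (hf w)

end Thick
end ModifiedSchmidt

/-! ### The theorem. -/

theorem corollary3p4
    {V : Type*} [NormedAddCommGroup V] [NormedSpace ℝ V] [FiniteDimensional ℝ V]
    {H : Type*} [MetricSpace H] [ConnectedSpace H] [Group H] [ChartedSpace V H]
    [LieGroup 𝓘(ℝ, V) ∞ H]
    [Bundle.RiemannianBundle (fun x : H => TangentSpace 𝓘(ℝ, V) x)]
    [IsContMDiffRiemannianBundle 𝓘(ℝ, V) ∞ V (fun x : H => TangentSpace 𝓘(ℝ, V) x)]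
    [IsRiemannianManifold 𝓘(ℝ, V) H]
    (hinv : ModifiedSchmidt.IsRightInvariantMetric (V := V) H)
    (Φ : ℝ → H ≃ₜ* H) (hΦ : ModifiedSchmidt.IsContractingOneParameterGroup Φ)
    (D₀ : Set H) (hD₀ : ModifiedSchmidt.IsAdmissible D₀) :
    (∃ aStar : ℝ, 0 ≤ aStar ∧
      ModifiedSchmidt.MSG0 (ModifiedSchmidt.inducedLE Φ D₀) aStar) ∧
    ∀ aStar : ℝ, 0 ≤ aStar →
      ModifiedSchmidt.MSG0 (ModifiedSchmidt.inducedLE Φ D₀) aStar →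
      ∀ S : Set H,
        ModifiedSchmidt.IsWinning (ModifiedSchmidt.inducedLE Φ D₀)
          (ModifiedSchmidt.inducedPsi Φ D₀) aStar S →
        ModifiedSchmidt.IsThick S := by
  have : IsTopologicalGroup H := topologicalGroup_of_lieGroup 𝓘(ℝ, V) ∞
  have : LocallyCompactSpace H := Manifold.locallyCompact_of_finiteDimensional 𝓘(ℝ, V)
  have : IsIsometricSMul Hᵐᵒᵖ H := ⟨fun g =>
    Isometry.of_dist_eq fun x y => dist_mul_right_eq hinv x y g.unop⟩
  have : SecondCountableTopology H := secondCountableTopology_of_connected_locallyCompact_group H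
  refine ⟨hD₀.exists_msg0 hΦ, fun aStar haStar _ S hS U hU hUne => ?_⟩
  let _ : MeasurableSpace H := borel H
  have : BorelSpace H := ⟨rfl⟩
  obtain ⟨R, C, hφ, hC, hlow⟩ := exists_isLocalLog_unitChart V H
  have hR := hφ.pos
  obtain ⟨σ, hσ, hexp⟩ := hφ.exists_dist_le_exp hC hlow hΦ
  obtain ⟨B₀, hB₀, hexp⟩ := hexp D₀ hD₀.1
  obtain ⟨C', hC', hbi⟩ := hφ.exists_bilipschitz hlow hC
  obtain ⟨hfin, hpos, B, hB, hball⟩ := hausdorffMeasure_of_bilipschitz (r := R / 4) (by positivity)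
    hC' unitChart_one hbi fun U hU => image_unitChart_mem_nhds hU
  refine le_antisymm (dimH_mono (subset_univ _))
    ((dimH_univ_le_of_sigmaCompact (Module.finrank ℝ V)).trans ?_)
  -- The parameter `b` depends on `s`, so the bound is proved for each `s < n` separately;
  -- `a`-winning sets allow every `b > aStar`.
  refine le_of_forall_lt fun d hd => ?_
  obtain ⟨s, hds, hsn⟩ := ENNReal.lt_iff_exists_nnreal_btwn.1 hd
  exact hds.trans_le (hS.le_dimH_inter hΦ hD₀ hσ hB₀ hexp _ hB (by positivity) hball haStar hU hUne
    (by exact_mod_cast hsn))
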